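/- **Theorem 4.1 (Poincaré residue).** Let $G,H$ be complex Lie groups, $q=\dim H$, $\mathfrak h=\mathrm{Lie}(H)$, and let $\pi:M\to X$ be a $G$-equivariant holomorphic principal $H$-bundle over a connected complex manifold $X$ of dimension $d$; $H$ acts on $M$ by $h\cdot m=mh^{-1}$, this action commutes with that of $G$, and a group element $a$ acts on forms by $\Gamma_a\alpha=(a^{-1})^*\alpha$. Let $(\omega_M,\chi_M)$ be a CY structure on $M$: $\omega_M$ is a nowhere vanishing holomorphic top form on $M$ and $\chi_M:H\to\mathbb C^\times$ a holomorphic character with $\Gamma_h\omega_M=\chi_M(h)\omega_M$ for $h\in H$. Fix a basis $x_1,\dots,x_q$ of $\mathfrak h$, let $\xi_x$ be the vector field $(\xi_x)_m=\frac{d}{dt}|_{t=0}\,m\exp(tx)$ on $M$, put $\iota_x=\iota_{\xi_x}$ and $$\Omega=\iota_{x_1}\cdots\iota_{x_q}\omega_M .$$ Let $\chi$ be a holomorphic character of $H$ and $L=L_\chi=M\times_H\mathbb C_\chi$ (so $[mh^{-1},\chi(h)v]=[m,v]$), with $G$-action $g[m,v]=[gm,v]$. Let $0\ne\sigma\in H^0(X,L)$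 and $\tau\in H^0(X,L\otimes K_X)$; for $g\in G$ let $\Gamma_g\sigma=g\circ\sigma\circ g^{-1}$ and $\Gamma_g\tau=g\circ\tau\circ g^{-1}$, with the natural $G$-action on $K_X$. 1. There are unique functions $\sigma_M,\tau_M:M\to\mathbb C$ with $\sigma(\pi(m))=[m,\sigma_M(m)]$ and $\tau(\pi(m))=[m,\tau_M(m)]\otimes\kappa_m$ for all $m\in M$, where $\kappa_m\in K_X|_{\pi(m)}$ is the element with $\pi^*\kappa_m=\Omega_m$. They are holomorphic, and $\sigma_M(mh^{-1})=\chi(h)\sigma_M(m)$, $\tau_M(mh^{-1})=\chi(h)\chi_M(h)\chi_{\mathfrak h}(h)\tau_M(m)$ for $h\in H$, where $\chi_{\mathfrak h}(h)=\det \mathrm{Ad}(h)$. 2. $\Omega$ is a nowhere vanishing holomorphic $d$-form on $M$, and $\{\sigma_M\ne0\}$ is dense. Hence $\Omega_\sigma:=\frac1{\sigma_M}\Omega$ is a meromorphic $d$-form on $M$ with polar divisor $\sigma_M=0$, holomorphic and nowhere vanishing on $M-\{\sigma_M=0\}$. 3. For every $g\in G$, $\Gamma_g\sigma$ and $\Gamma_g\tau$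 are again holomorphic sections, $(\Gamma_g\sigma)_M=\sigma_M\circ g^{-1}$, and $$\Gamma_g(\tau_M\Omega_\sigma)=(\Gamma_g\tau)_M\,\Omega_{\Gamma_g\sigma}$$ on $\{(\Gamma_g\sigma)_M\ne0\}$. If moreover $\Gamma_g\omega_M=\omega_M$, then $(\Gamma_g\tau)_M=\tau_M\circ g^{-1}$, so that $\Gamma_g(\tau_M\Omega_\sigma)=(\tau_M\circ g^{-1})\,\Omega_{\Gamma_g\sigma}$. 4. On $M-\{\sigma_M=0\}$ the form $\tau_M\Omega_\sigma$ is $H$-basic: $\iota_x(\tau_M\Omega_\sigma)=0$ and $\Gamma_h(\tau_M\Omega_\sigma)=\tau_M\Omega_\sigma$ for $x\in\mathfrak h$, $h\in H$. 5. There is a unique $d$-form $\eta$ on $X-\{\sigma=0\}$ with $\pi^*\eta=\tau_M\Omega_\sigma$. It is holomorphic there and is a meromorphic $d$-form on $X$ with pole along the divisor $\sigma=0$: for every local holomorphic section $s$ of $M$ over an open set $U$, writing $\sigma=[s,f]$ on $U$, the set $\{f\neq 0\}$ is dense in $U$ and $f\eta$ extends to a holomorphic $d$-form on $U$. Moreover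 $\sigma\otimes\eta=\tau$ on $X-\{\sigma=0\}$. -/

import Mathlib

open Set
open scoped Manifold ContDiff TensorProduct Topology

noncomputable section

/-! ### Differential forms on complex manifolds

A complex manifold is a manifold over `ℂ`, of class `C^ω`, modelled on a finite dimensional
complex vector space `E`.  A (not necessarily continuous) `k`-form is a family of alternating
`k`-linear forms on the tangent spaces. -/

/-- The fibre at `p` of the bundle `⋀ᵏ T^*N` of holomorphic cotangent `k`-vectors. -/
abbrev FormAt (E : Type*) [NormedAddCommGroup E] [NormedSpace ℂ E]
    {N : Type*} [TopologicalSpace N] [ChartedSpace E N] (k : ℕ) (p : N) : Type _ :=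
  (TangentSpace 𝓘(ℂ, E) p) [⋀^Fin k]→ₗ[ℂ] ℂ

/-- Set-theoretic sections of `⋀ᵏ T^*N`. -/
abbrev Form (E : Type*) [NormedAddCommGroup E] [NormedSpace ℂ E]
    (N : Type*) [TopologicalSpace N] [ChartedSpace E N] (k : ℕ) : Type _ :=
  ∀ p : N, FormAt E k p

section Forms

variable {E : Type*} [NormedAddCommGroup E] [NormedSpace ℂ E]
  {N : Type*} [TopologicalSpace N] [ChartedSpace E N]

/-- `α` is a holomorphic `k`-form on the open set `U`: in every chart of the atlas its
coefficients (its values on constant vectors of `E`) are holomorphic, that is, complex analytic, functions. -/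
def IsHolForm {k : ℕ} (U : Set N) (α : Form E N k) : Prop :=
  ∀ (p : N) (v : Fin k → E),
    ContDiffOn ℂ ω
      (fun y : E => α ((chartAt E p).symm y)
        (fun i => mfderiv 𝓘(ℂ, E) 𝓘(ℂ, E) (chartAt E p).symm y (v i)))
      ((chartAt E p).target ∩ (chartAt E p).symm ⁻¹' U)

/-- Pullback at the point `p` of a covector `α ∈ ⋀ᵏ T^*_{f p}` along `f`. -/
def pullbackAt {E' : Type*} [NormedAddCommGroup E'] [NormedSpace ℂ E']
    {N' : Type*} [TopologicalSpace N'] [ChartedSpace E' N'] {k : ℕ}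
    (f : N → N') (p : N) (α : FormAt E' k (f p)) : FormAt E k p :=
  α.compLinearMap (mfderiv 𝓘(ℂ, E) 𝓘(ℂ, E') f p).toLinearMap

/-- The natural action `Γ_g α = (g⁻¹)^* α` on forms, for a group acting on `N`. -/
def gammaForm {A : Type*} [Group A] [MulAction A N] {k : ℕ} (g : A) (α : Form E N k) :
    Form E N k :=
  fun p => pullbackAt (fun p' : N => g⁻¹ • p') p (α (g⁻¹ • p))

/-- Interior multiplication of an alternating form by a vector: the vector is inserted in the
first slot; it is `0` on `0`-forms. -/
def interiorMul {V : Type*} [AddCommGroup V] [Module ℂ V] :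
    {k : ℕ} → V → (V [⋀^Fin k]→ₗ[ℂ] ℂ) → (V [⋀^Fin (k - 1)]→ₗ[ℂ] ℂ)
  | 0, _, _ => 0
  | _ + 1, v, α => α.curryLeft v

/-- The iterated interior multiplication `ι_{v_1} ⋯ ι_{v_q} α` (so `ι_{v_q}` acts first). -/
def interiorIter {V : Type*} [AddCommGroup V] [Module ℂ V] {n : ℕ} :
    (q : ℕ) → (Fin q → V) → (V [⋀^Fin (n + q)]→ₗ[ℂ] ℂ) → (V [⋀^Fin n]→ₗ[ℂ] ℂ)
  | 0, _, α => α
  | q + 1, v, α =>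
      interiorIter q (fun i => v i.castSucc) (interiorMul (k := n + q + 1) (v (Fin.last q)) α)

/-- `α` is a meromorphic `k`-form on the open set `U` with poles at most along the divisor of
the holomorphic function `f`: the function `f` does not vanish identically on any nonempty open
subset of `U`, `α` is holomorphic on `U - {f = 0}`, and `f α` extends to a holomorphic form
on `U`. -/
def IsMeroForm {k : ℕ} (U : Set N) (f : N → ℂ) (α : Form E N k) : Prop :=
  ContMDiffOn 𝓘(ℂ, E) 𝓘(ℂ, ℂ) ω f U ∧
  U ⊆ closure {p | p ∈ U ∧ f p ≠ 0} ∧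
  IsHolForm {p | p ∈ U ∧ f p ≠ 0} α ∧
  ∃ β : Form E N k, IsHolForm U β ∧ ∀ p ∈ U, f p ≠ 0 → f p • α p = β p

end Forms

/-! ### Equivariant principal bundles -/

/-- A `G`-equivariant holomorphic principal `H`-bundle `H - M → X`.  The group `H` acts on `M` by
`h • m = m h⁻¹`, where `m h` is the right action of the principal bundle.  The bundle is locally
trivial: over a neighbourhood `U` of any point there are a holomorphic section `s` and a
holomorphic map `c : M|U → H` such that `(x, h) ↦ h • s x` and `m ↦ (proj m, c m)` are inverse
bijections between `U × H` and `M|U`. -/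
structure EquivPrincipalBundle
    (EG : Type*) [NormedAddCommGroup EG] [NormedSpace ℂ EG]
    (EH : Type*) [NormedAddCommGroup EH] [NormedSpace ℂ EH]
    (EM : Type*) [NormedAddCommGroup EM] [NormedSpace ℂ EM]
    (EX : Type*) [NormedAddCommGroup EX] [NormedSpace ℂ EX]
    (G : Type*) [Group G] [TopologicalSpace G] [ChartedSpace EG G]
    (H : Type*) [Group H] [TopologicalSpace H] [ChartedSpace EH H]
    (M : Type*) [TopologicalSpace M] [ChartedSpace EM M]
    (X : Type*) [TopologicalSpace X] [ChartedSpace EX X]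
    [MulAction G M] [MulAction H M] [MulAction G X] [SMulCommClass G H M] where
  proj : M → X
  holo_proj : ContMDiff 𝓘(ℂ, EM) 𝓘(ℂ, EX) ω proj
  holo_G : ContMDiff (𝓘(ℂ, EG).prod 𝓘(ℂ, EM)) 𝓘(ℂ, EM) ω (fun p : G × M => p.1 • p.2)
  holo_H : ContMDiff (𝓘(ℂ, EH).prod 𝓘(ℂ, EM)) 𝓘(ℂ, EM) ω (fun p : H × M => p.1 • p.2)
  holo_G_base : ContMDiff (𝓘(ℂ, EG).prod 𝓘(ℂ, EX)) 𝓘(ℂ, EX) ω (fun p : G × X => p.1 • p.2)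
  proj_G : ∀ (g : G) (m : M), proj (g • m) = g • proj m
  proj_H : ∀ (h : H) (m : M), proj (h • m) = proj m
  locTriv : ∀ x₀ : X, ∃ U : Set X, IsOpen U ∧ x₀ ∈ U ∧ ∃ (s : X → M) (c : M → H),
    ContMDiffOn 𝓘(ℂ, EX) 𝓘(ℂ, EM) ω s U ∧
    ContMDiffOn 𝓘(ℂ, EM) 𝓘(ℂ, EH) ω c (proj ⁻¹' U) ∧
    (∀ x ∈ U, proj (s x) = x) ∧
    (∀ m ∈ proj ⁻¹' U, c m • s (proj m) = m) ∧
    (∀ x ∈ U, ∀ h : H, c (h • s x) = h)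

/-- An `H`-character: a holomorphic homomorphism `H → ℂˣ`. -/
def IsHolCharacter (EH : Type*) [NormedAddCommGroup EH] [NormedSpace ℂ EH]
    {H : Type*} [Group H] [TopologicalSpace H] [ChartedSpace EH H] (χ : H →* ℂˣ) : Prop :=
  ContMDiff 𝓘(ℂ, EH) 𝓘(ℂ, ℂ) ω (fun h => (χ h : ℂ))

/-- The relation `(m, v) ∼ (h • m, χ(h) v)` on `M × ℂ`. -/
def assocSetoid {H : Type*} [Group H] (M : Type*) [MulAction H M] (χ : H →* ℂˣ) :
    Setoid (M × ℂ) where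
  r a b := ∃ h : H, b = (h • a.1, (χ h : ℂ) * a.2)
  iseqv :=
    { refl := fun a => ⟨1, by simp⟩
      symm := by
        rintro a b ⟨h, rfl⟩
        exact ⟨h⁻¹, by simp⟩
      trans := by
        rintro a b c ⟨h, rfl⟩ ⟨h', rfl⟩
        exact ⟨h' * h, by simp [mul_smul, mul_assoc]⟩ }

/-- The total space of the line bundle `L_χ = M ×_H ℂ_χ`. -/
def AssocLine {H : Type*} [Group H] (M : Type*) [MulAction H M] (χ : H →* ℂˣ) : Type _ :=
  Quotient (assocSetoid M χ)

namespace AssocLine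

variable {G : Type*} [Group G] {H : Type*} [Group H] {M : Type*} [MulAction G M] [MulAction H M]
  [SMulCommClass G H M]

/-- The class `[m, v]`. -/
def mk (χ : H →* ℂˣ) (m : M) (v : ℂ) : AssocLine M χ := Quotient.mk (assocSetoid M χ) (m, v)

theorem mk_eq_iff (χ : H →* ℂˣ) (m m' : M) (v v' : ℂ) :
    mk χ m v = mk χ m' v' ↔ ∃ h : H, m' = h • m ∧ v' = (χ h : ℂ) * v := by
  refine (Quotient.eq (r := assocSetoid M χ)).trans ?_
  change (∃ h : H, (m', v') = (h • m, (χ h : ℂ) * v)) ↔ _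
  simp [Prod.ext_iff]

/-- The action `g [m, v] = [g m, v]`. -/
def act (χ : H →* ℂˣ) (g : G) : AssocLine M χ → AssocLine M χ :=
  Quotient.lift (fun a : M × ℂ => mk χ (g • a.1) a.2) (by
    rintro a b ⟨h, rfl⟩
    exact (mk_eq_iff χ _ _ _ _).2 ⟨h, smul_comm g h a.1, rfl⟩)

theorem act_mk (χ : H →* ℂˣ) (g : G) (m : M) (v : ℂ) :
    act χ g (mk χ m v) = mk χ (g • m) v := rfl

end AssocLine

namespace EquivPrincipalBundle

variable
    {EG : Type*} [NormedAddCommGroup EG] [NormedSpace ℂ EG]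
    {EH : Type*} [NormedAddCommGroup EH] [NormedSpace ℂ EH]
    {EM : Type*} [NormedAddCommGroup EM] [NormedSpace ℂ EM]
    {EX : Type*} [NormedAddCommGroup EX] [NormedSpace ℂ EX]
    {G : Type*} [Group G] [TopologicalSpace G] [ChartedSpace EG G]
    {H : Type*} [Group H] [TopologicalSpace H] [ChartedSpace EH H]
    {M : Type*} [TopologicalSpace M] [ChartedSpace EM M]
    {X : Type*} [TopologicalSpace X] [ChartedSpace EX X]
    [MulAction G M] [MulAction H M] [MulAction G X] [SMulCommClass G H M]
    (P : EquivPrincipalBundle EG EH EM EX G H M X) (χ : H →* ℂˣ)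

theorem exists_proj_eq (x : X) : ∃ m : M, P.proj m = x := by
  obtain ⟨U, -, hx, s, c, -, -, hs, -, -⟩ := P.locTriv x
  exact ⟨s x, hs x hx⟩

theorem exists_smul_eq {m m' : M} (hm : P.proj m = P.proj m') : ∃ h : H, h • m = m' := by
  obtain ⟨U, -, hx, s, c, -, -, -, hc, -⟩ := P.locTriv (P.proj m)
  have h1 := hc m hx
  have h2 := hc m' (by simpa [← hm] using hx)
  rw [← hm] at h2
  refine ⟨c m' * (c m)⁻¹, ?_⟩
  calc (c m' * (c m)⁻¹) • m = (c m' * (c m)⁻¹) • (c m • s (P.proj m)) := by rw [h1]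
    _ = m' := by rw [← mul_smul, inv_mul_cancel_right, h2]

theorem eq_one_of_smul_eq (P : EquivPrincipalBundle EG EH EM EX G H M X) {h : H} {m : M} (hm : h • m = m) : h = 1 := by
  obtain ⟨U, -, hx, s, c, -, -, -, hc, hc'⟩ := P.locTriv (P.proj m)
  have h1 := hc m hx
  have h2 := hc' _ hx (h * c m)
  rw [mul_smul, h1, hm] at h2
  simpa using h2.symm

/-! ### The fibres of `L_χ` as one-dimensional vector spaces -/

/-- The fibre `(L_χ)_x`: all classes `[m, v]` with `m` above `x`. -/
def Fiber (x : X) : Type _ :=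
  {l : AssocLine M χ // ∃ (m : M) (v : ℂ), P.proj m = x ∧ AssocLine.mk χ m v = l}

/-- The class `[m, v]` in the fibre of `L_χ` at `x = proj m`. -/
def cls {x : X} (m : M) (hm : P.proj m = x) (v : ℂ) : P.Fiber χ x :=
  ⟨AssocLine.mk χ m v, m, v, hm, rfl⟩

theorem cls_bijective {x : X} (m : M) (hm : P.proj m = x) :
    Function.Bijective (P.cls χ m hm) := by
  constructor
  · intro v v' h
    obtain ⟨k, hk, hv⟩ := (AssocLine.mk_eq_iff χ _ _ _ _).1 (congrArg Subtype.val h)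
    have := P.eq_one_of_smul_eq hk.symm
    subst this
    simpa using hv.symm
  · rintro ⟨l, m', v, hm', rfl⟩
    obtain ⟨k, hk⟩ := P.exists_smul_eq (hm'.trans hm.symm)
    exact ⟨(χ k : ℂ) * v,
      Subtype.ext ((AssocLine.mk_eq_iff χ _ _ _ _).2 ⟨k, hk.symm, rfl⟩).symm⟩

/-- A point of `M` above `x` identifies the fibre of `L_χ` at `x` with `ℂ`. -/
def fiberEquiv {x : X} (m : M) (hm : P.proj m = x) : ℂ ≃ P.Fiber χ x :=
  Equiv.ofBijective _ (P.cls_bijective χ m hm)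

/-- A reference point above `x`; the linear structure below does not depend on it. -/
def refPt (x : X) : M := (P.exists_proj_eq x).choose

theorem proj_refPt (x : X) : P.proj (P.refPt x) = x := (P.exists_proj_eq x).choose_spec

/-- The vector space structure of `(L_χ)_x`: `[m, v] + [m, w] = [m, v + w]`. -/
instance (x : X) : AddCommGroup (P.Fiber χ x) :=
  (P.fiberEquiv χ (P.refPt x) (P.proj_refPt x)).symm.addCommGroup

/-- Scalar multiplication in `(L_χ)_x`: `a [m, v] = [m, a v]`. -/
instance (x : X) : Module ℂ (P.Fiber χ x) :=
  (P.fiberEquiv χ (P.refPt x) (P.proj_refPt x)).symm.module ℂ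

theorem cls_eq_ref {x : X} (m : M) (hm : P.proj m = x) :
    ∃ a : ℂ, ∀ v, P.cls χ m hm v = P.fiberEquiv χ (P.refPt x) (P.proj_refPt x) (a * v) := by
  obtain ⟨k, hk⟩ := P.exists_smul_eq (hm.trans (P.proj_refPt x).symm)
  exact ⟨(χ k : ℂ), fun v =>
    Subtype.ext ((AssocLine.mk_eq_iff χ _ _ _ _).2 ⟨k, hk.symm, rfl⟩)⟩

theorem cls_add {x : X} (m : M) (hm : P.proj m = x) (v w : ℂ) :
    P.cls χ m hm (v + w) = P.cls χ m hm v + P.cls χ m hm w := by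
  obtain ⟨a, ha⟩ := P.cls_eq_ref χ m hm
  rw [ha, ha, ha, Equiv.add_def]
  simp [mul_add]

theorem cls_smul {x : X} (m : M) (hm : P.proj m = x) (a v : ℂ) :
    P.cls χ m hm (a * v) = a • P.cls χ m hm v := by
  obtain ⟨b, hb⟩ := P.cls_eq_ref χ m hm
  rw [hb, hb, Equiv.smul_def]
  simp [mul_left_comm]

/-- The action of `g` as a linear map `(L_χ)_{g⁻¹ x} → (L_χ)_x`, `[m, v] ↦ [g m, v]`. -/
def actFiber (g : G) (x : X) : P.Fiber χ (g⁻¹ • x) →ₗ[ℂ] P.Fiber χ x where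
  toFun l := ⟨AssocLine.act χ g l.1, by
    obtain ⟨l, m, v, hm, rfl⟩ := l
    exact ⟨g • m, v, by rw [P.proj_G, hm, smul_inv_smul], rfl⟩⟩
  map_add' a b := by
    have hm : P.proj (g • P.refPt (g⁻¹ • x)) = x := by
      rw [P.proj_G, P.proj_refPt, smul_inv_smul]
    obtain ⟨v, rfl⟩ := (P.cls_bijective χ _ (P.proj_refPt (g⁻¹ • x))).2 a
    obtain ⟨w, rfl⟩ := (P.cls_bijective χ _ (P.proj_refPt (g⁻¹ • x))).2 b
    rw [← cls_add]
    exact P.cls_add χ _ hm v w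
  map_smul' c a := by
    have hm : P.proj (g • P.refPt (g⁻¹ • x)) = x := by
      rw [P.proj_G, P.proj_refPt, smul_inv_smul]
    obtain ⟨v, rfl⟩ := (P.cls_bijective χ _ (P.proj_refPt (g⁻¹ • x))).2 a
    rw [← cls_smul]
    exact P.cls_smul χ _ hm c v

/-- The action of `g` as a linear map `⋀ᵈT^*_{g⁻¹ x} → ⋀ᵈT^*_x`, the pullback by `g⁻¹`. -/
def actForm (_P : EquivPrincipalBundle EG EH EM EX G H M X) (d : ℕ) (g : G) (x : X) :
    FormAt EX d (g⁻¹ • x) →ₗ[ℂ] FormAt EX d x where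
  toFun κ := pullbackAt (fun y : X => g⁻¹ • y) x κ
  map_add' _ _ := rfl
  map_smul' _ _ := rfl

/-! ### Sections of `L_χ` and of `L_χ ⊗ K_X` -/

/-- Set-theoretic sections of `L_χ`. -/
abbrev Sec : Type _ := ∀ x : X, P.Fiber χ x

/-- Set-theoretic sections of `L_χ ⊗ ⋀ᵈT^*X`; this is `L_χ ⊗ K_X` when `d = dim X`. -/
abbrev SecK (d : ℕ) : Type _ := ∀ x : X, P.Fiber χ x ⊗[ℂ] FormAt EX d x

/-- `σ ∈ H⁰(X, L_χ)`: in the local frame `[s, 1]` of `L_χ` given by any local holomorphic section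
`s` of `M`, the coefficient of `σ` is holomorphic. -/
def IsHolSec (σ : P.Sec χ) : Prop :=
  ∀ (U : Set X) (s : X → M), IsOpen U → ContMDiffOn 𝓘(ℂ, EX) 𝓘(ℂ, EM) ω s U →
    ∀ hs : ∀ x ∈ U, P.proj (s x) = x,
    ∃ f : X → ℂ, ContMDiffOn 𝓘(ℂ, EX) 𝓘(ℂ, ℂ) ω f U ∧
      ∀ (x : X) (hx : x ∈ U), σ x = P.cls χ (s x) (hs x hx) (f x)

/-- `τ ∈ H⁰(X, L_χ ⊗ K_X)`: in the local frame `[s, 1]` of `L_χ` given by any local holomorphic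
section `s` of `M`, the coefficient of `τ` is a holomorphic `d`-form. -/
def IsHolSecK {d : ℕ} (τ : P.SecK χ d) : Prop :=
  ∀ (U : Set X) (s : X → M), IsOpen U → ContMDiffOn 𝓘(ℂ, EX) 𝓘(ℂ, EM) ω s U →
    ∀ hs : ∀ x ∈ U, P.proj (s x) = x,
    ∃ κ : Form EX X d, IsHolForm U κ ∧
      ∀ (x : X) (hx : x ∈ U), τ x = P.cls χ (s x) (hs x hx) 1 ⊗ₜ[ℂ] κ x

/-- `Γ_g σ = g ∘ σ ∘ g⁻¹` for sections of `L_χ`. -/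
def gammaSec (g : G) (σ : P.Sec χ) : P.Sec χ :=
  fun x => P.actFiber χ g x (σ (g⁻¹ • x))

/-- `Γ_g τ = g ∘ τ ∘ g⁻¹` for sections of `L_χ ⊗ K_X`, with the natural action of `g` on `K_X`. -/
def gammaSecK {d : ℕ} (g : G) (τ : P.SecK χ d) : P.SecK χ d :=
  fun x => TensorProduct.map (P.actFiber χ g x) (P.actForm d g x) (τ (g⁻¹ • x))

/-- The function `σ_M` on `M` representing a section `σ` of `L_χ`: it is defined by
`σ (proj m) = [m, σ_M m]`. -/
def funOfSec (σ : P.Sec χ) (m : M) : ℂ := (P.fiberEquiv χ m rfl).symm (σ (P.proj m))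

/-- Defining property of `σ_M`. -/
theorem cls_funOfSec (σ : P.Sec χ) (m : M) :
    P.cls χ m rfl (P.funOfSec χ σ m) = σ (P.proj m) :=
  (P.fiberEquiv χ m rfl).apply_symm_apply _

/-! ### The form `Ω` -/

/-- The vector field `ξ_x` on `M` generated by `x ∈ 𝔥`: the derivative of `m exp(t x)` at
`t = 0`. Recall that `m h = h⁻¹ • m`. -/
def vecField (_P : EquivPrincipalBundle EG EH EM EX G H M X)
    (x : TangentSpace 𝓘(ℂ, EH) (1 : H)) (m : M) : TangentSpace 𝓘(ℂ, EM) m :=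
  (mfderiv 𝓘(ℂ, EH) 𝓘(ℂ, EM) (fun h : H => h⁻¹ • m) 1 x : EM)

/-- `(ω_M, χ_M)` is a CY structure on `M`, `n = dim M`: a nowhere vanishing holomorphic top form
with `Γ_h ω_M = χ_M(h) ω_M` for an `H`-character `χ_M`. -/
def IsCYStructure (_P : EquivPrincipalBundle EG EH EM EX G H M X)
    {n : ℕ} (ωM : Form EM M n) (χM : H →* ℂˣ) : Prop :=
  Module.finrank ℂ EM = n ∧ IsHolForm univ ωM ∧ (∀ m, ωM m ≠ 0) ∧ IsHolCharacter EH χM ∧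
    ∀ (h : H) (m : M), gammaForm h ωM m = (χM h : ℂ) • ωM m

/-- `Ω = ι_{x_1} ⋯ ι_{x_q} ω_M`. -/
def Omega {d q : ℕ} (ωM : Form EM M (d + q)) (b : Fin q → TangentSpace 𝓘(ℂ, EH) (1 : H)) :
    Form EM M d :=
  fun m => interiorIter q (fun i => P.vecField (b i) m) (ωM m)

/-- `Ω_σ = (1 / σ_M) Ω`; only its values where `σ_M ≠ 0` are meaningful. -/
def OmegaSec {d q : ℕ} (ωM : Form EM M (d + q)) (b : Fin q → TangentSpace 𝓘(ℂ, EH) (1 : H))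
    (σ : P.Sec χ) : Form EM M d :=
  fun m => (P.funOfSec χ σ m)⁻¹ • P.Omega ωM b m

/-- The canonical isomorphism `L_{χ_M χ_𝔥} ≅ K_X` sends `[m, 1]` to the `κ ∈ K_X` with
`proj^* κ = Ω` at `m`.  Accordingly the number `c` represents `τ`, a section of `L_χ ⊗ K_X`, at
`m` when `τ (proj m) = [m, c] ⊗ κ` for this `κ`. -/
def RepresentsAt {d : ℕ} (Ω : Form EM M d) (τ : P.SecK χ d) (m : M) (c : ℂ) : Prop :=
  ∃ κ : FormAt EX d (P.proj m), pullbackAt P.proj m κ = Ω m ∧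
    τ (P.proj m) = P.cls χ m rfl c ⊗ₜ[ℂ] κ

/-- The function `τ_M` on `M` representing a section `τ` of `L_χ ⊗ K_X`. -/
def funOfSecK {d : ℕ} (Ω : Form EM M d) (τ : P.SecK χ d) (m : M) : ℂ :=
  Classical.epsilon (P.RepresentsAt χ Ω τ m)

/-- `η` is a meromorphic `d`-form on `X` with poles at most along the divisor of the section
`σ` of `L_χ`: this holds on `U` for the coefficient `f` of `σ` in any frame `[s, 1]` over `U`. -/
def IsMeroAlong {d : ℕ} (σ : P.Sec χ) (η : Form EX X d) : Prop :=
  ∀ (U : Set X) (s : X → M), IsOpen U → ContMDiffOn 𝓘(ℂ, EX) 𝓘(ℂ, EM) ω s U →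
    ∀ hs : ∀ x ∈ U, P.proj (s x) = x,
    ∀ f : X → ℂ, (∀ (x : X) (hx : x ∈ U), σ x = P.cls χ (s x) (hs x hx) (f x)) →
      IsMeroForm U f η

end EquivPrincipalBundle

/-- The value at `h` of the character `χ_𝔥` of `H` on `⋀^q 𝔥`: the determinant of `Ad h`. -/
def detAd (EH : Type*) [NormedAddCommGroup EH] [NormedSpace ℂ EH]
    {H : Type*} [Group H] [TopologicalSpace H] [ChartedSpace EH H] (h : H) : ℂ :=
  LinearMap.det (M := EH)
    (mfderiv 𝓘(ℂ, EH) 𝓘(ℂ, EH) (fun k : H => h * k * h⁻¹) 1 : EH →L[ℂ] EH).toLinearMap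

end

/-! ### Holomorphic forms and parametrized pieces of a manifold -/

/-! The vectors `P.vecField (b i) m` are independent because the action is infinitesimally free, and
by counting dimensions they span the kernel of the differential of `P.proj` at `m`. Contracting a
nonzero top form with this vertical frame therefore gives a nonzero form that kills vertical
vectors, so `Ω` at `m` is the pullback of a unique generator of the line `K_X` at `P.proj m`. This
is what makes `τ_M` exist and be unique (`mem_span_vecField`, `exists_pullbackAt_proj_eq_Omega`,
`exists_representsAt`).

Equivariance comes from the vector fields. The group `G` commutes with `H` and preserves them, while
`h` twists them by `Ad h`, so that `Ω` picks up the product of `χM` and `detAd` (`gammaForm_Omega`,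
`smul_pullbackAt_smul_Omega`). In `τ_M Ω / σ_M` all three characters cancel.

The residue is the quotient `τ / σ`: in a frame `[s, 1]` it is a holomorphic form divided by the
coefficient `f` of `σ`, and its pullback to `M` is `τ_M Ω / σ_M` by pointwise linear algebra
(`isMeroAlong_secQuotient`, `pullbackAt_proj_secQuotient`). Uniqueness holds because pullback along
a submersion is injective, and density of the nonvanishing locus is the identity theorem on the
connected base (`exists_mem_ne_zero`).

Holomorphy of `Ω` is read off from the coefficients of `ωM` in a parametrization by `EM × EH`, and
that of `τ_M` by dividing the holomorphic form `τ_M Ω` by `Ω`. -/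

section HolomorphicForms

variable {E : Type*} [NormedAddCommGroup E] [NormedSpace ℂ E]
  {N : Type*} [TopologicalSpace N] [ChartedSpace E N] {k : ℕ}

theorem AlternatingMap.map_eq_sum_basis {ι V : Type*} [Fintype ι] [AddCommGroup V] [Module ℂ V]
    (B : Module.Basis ι ℂ V) (α : V [⋀^Fin k]→ₗ[ℂ] ℂ) (v : Fin k → V) :
    α v = ∑ r : Fin k → ι, (∏ i, B.repr (v i) (r i)) * α (fun i => B (r i)) := by
  classical
  have h : v = fun i => ∑ j, B.repr (v i) j • B j := by
    funext i
    exact (B.sum_repr (v i)).symm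
  conv_lhs => rw [h]
  rw [← AlternatingMap.coe_multilinearMap, MultilinearMap.map_sum]
  refine Finset.sum_congr rfl fun r _ => ?_
  rw [MultilinearMap.map_smul_univ, smul_eq_mul, AlternatingMap.coe_multilinearMap]

theorem isOpen_chart_target_inter_preimage {E N : Type*} [NormedAddCommGroup E]
    [TopologicalSpace N] [ChartedSpace E N] {U : Set N} (hU : IsOpen U) (p : N) :
    IsOpen ((chartAt E p).target ∩ (chartAt E p).symm ⁻¹' U) :=
  (chartAt E p).symm.isOpen_inter_preimage hU

theorem IsHolForm.mono {U W : Set N} {α : Form E N k} (h : IsHolForm U α) (hW : W ⊆ U) :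
    IsHolForm W α :=
  fun p v => (h p v).mono fun _ hy => ⟨hy.1, hW hy.2⟩

theorem IsHolForm.congr {U : Set N} {α β : Form E N k} (h : IsHolForm U α)
    (hαβ : ∀ p ∈ U, β p = α p) : IsHolForm U β := by
  intro p v
  exact (h p v).congr fun y hy => AlternatingMap.congr_fun (hαβ _ hy.2) _

theorem IsHolForm.of_locally {U : Set N} {α : Form E N k}
    (h : ∀ p ∈ U, ∃ W, IsOpen W ∧ p ∈ W ∧ IsHolForm W α) : IsHolForm U α := by
  intro p v y hy
  obtain ⟨W, hW, hyW, hα⟩ := h _ hy.2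
  exact ((hα p v).contDiffAt
    ((isOpen_chart_target_inter_preimage hW p).mem_nhds ⟨hy.1, hyW⟩)).contDiffWithinAt

variable [IsManifold 𝓘(ℂ, E) ω N]

theorem IsHolForm.smul {U : Set N} {α : Form E N k} {f : N → ℂ}
    (hf : ContMDiffOn 𝓘(ℂ, E) 𝓘(ℂ, ℂ) ω f U) (h : IsHolForm U α) :
    IsHolForm U (fun p => f p • α p) := by
  intro p v
  have h1 : ContMDiffOn 𝓘(ℂ, E) 𝓘(ℂ, ℂ) ω (f ∘ (chartAt E p).symm)
      ((chartAt E p).target ∩ (chartAt E p).symm ⁻¹' U) :=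
    hf.comp ((contMDiffOn_chart_symm (I := 𝓘(ℂ, E)) (x := p)).mono inter_subset_left)
      fun y hy => hy.2
  exact (contMDiffOn_iff_contDiffOn.1 h1).mul (h p v)

/-- The coefficients of a holomorphic form are holomorphic in every holomorphic parametrization,
not only in charts. -/
theorem IsHolForm.contDiffOn_param [FiniteDimensional ℂ E]
    {F : Type*} [NormedAddCommGroup F] [NormedSpace ℂ F]
    {U : Set N} {α : Form E N k} (h : IsHolForm U α) {V : Set F} (hV : IsOpen V) {φ : F → N}
    (hφ : ContMDiffOn 𝓘(ℂ, F) 𝓘(ℂ, E) ω φ V) (hVU : MapsTo φ V U) (v : Fin k → F) :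
    ContDiffOn ℂ ω (fun y => α (φ y) (fun i => mfderiv 𝓘(ℂ, F) 𝓘(ℂ, E) φ y (v i))) V := by
  intro y₀ hy₀
  set e := chartAt E (φ y₀) with he
  set V' := V ∩ φ ⁻¹' e.source with hV'
  have hV'o : IsOpen V' := hφ.continuousOn.isOpen_inter_preimage hV e.open_source
  have hy₀' : y₀ ∈ V' := ⟨hy₀, mem_chart_source E _⟩
  have hψ : ContDiffOn ℂ ω (e ∘ φ) V' :=
    contMDiffOn_iff_contDiffOn.1 <|
      (contMDiffOn_chart (I := 𝓘(ℂ, E)) (x := φ y₀)).comp (hφ.mono inter_subset_left)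
        fun y hy => hy.2
  let B := Module.finBasis ℂ E
  have hcoef : ∀ r : Fin k → Fin (Module.finrank ℂ E), ContDiffOn ℂ ω (fun y => α (e.symm (e (φ y)))
      (fun i => mfderiv 𝓘(ℂ, E) 𝓘(ℂ, E) e.symm (e (φ y)) (B (r i)))) V' := fun r =>
    (h (φ y₀) (fun i => B (r i))).comp hψ fun y hy =>
      ⟨e.map_source hy.2, by
        change e.symm (e (φ y)) ∈ U
        rw [e.left_inv hy.2]; exact hVU hy.1⟩
  have hder : ∀ (w : F) (j : Fin (Module.finrank ℂ E)),
      ContDiffOn ℂ ω (fun y => B.repr (fderiv ℂ (e ∘ φ) y w) j) V' := fun w j => by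
    have h1 : ContDiffOn ℂ ω (fun y => fderiv ℂ (e ∘ φ) y w) V' :=
      (hψ.fderiv_of_isOpen hV'o (by simp)).clm_apply contDiffOn_const
    exact (LinearMap.toContinuousLinearMap (B.coord j)).contDiff.comp_contDiffOn h1
  -- Near `y₀` the map `φ` is `e.symm` after `e ∘ φ`; expanding in the basis `B` separates the chart
  -- coefficients of `α` from the derivatives of `e ∘ φ`.
  have key : ContDiffOn ℂ ω (fun y => ∑ r : Fin k → Fin (Module.finrank ℂ E),
      (∏ i, B.repr (fderiv ℂ (e ∘ φ) y (v i)) (r i)) * α (e.symm (e (φ y)))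
      (fun i => mfderiv 𝓘(ℂ, E) 𝓘(ℂ, E) e.symm (e (φ y)) (B (r i)))) V' :=
    ContDiffOn.sum fun r _ => (contDiffOn_prod fun i _ => hder _ _).mul (hcoef r)
  refine (((key y₀ hy₀').contDiffAt (hV'o.mem_nhds hy₀')).congr_of_eventuallyEq
    ?_).contDiffWithinAt
  filter_upwards [hV'o.mem_nhds hy₀'] with y hy
  have hmd : MDifferentiableAt 𝓘(ℂ, F) 𝓘(ℂ, E) (e ∘ φ) y :=
    ((hψ y hy).contDiffAt (hV'o.mem_nhds hy)).contMDiffAt.mdifferentiableAt (by simp)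
  have hmd' : MDifferentiableAt 𝓘(ℂ, E) 𝓘(ℂ, E) e.symm ((e ∘ φ) y) :=
    mdifferentiableAt_atlas_symm (chart_mem_atlas E _) (e.map_source hy.2)
  have hloc : φ =ᶠ[𝓝 y] e.symm ∘ (e ∘ φ) := by
    filter_upwards [hV'o.mem_nhds hy] with z hz
    exact (e.left_inv hz.2).symm
  have hd : ∀ w : F, mfderiv 𝓘(ℂ, F) 𝓘(ℂ, E) φ y w
      = mfderiv 𝓘(ℂ, E) 𝓘(ℂ, E) e.symm (e (φ y)) (fderiv ℂ (e ∘ φ) y w) := fun w => by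
    rw [hloc.mfderiv_eq, mfderiv_comp y hmd' hmd, mfderiv_eq_fderiv]
    rfl
  -- The points `φ y` and `e.symm (e (φ y))` agree only propositionally; all tangent spaces being
  -- copies of `E`, the base point can be generalized.
  have hpt : ∀ p : N, p = φ y → α (φ y) (fun i => mfderiv 𝓘(ℂ, F) 𝓘(ℂ, E) φ y (v i))
      = α p (fun i => (mfderiv 𝓘(ℂ, F) 𝓘(ℂ, E) φ y (v i) : E)) := by
    rintro p rfl; rfl
  rw [hpt _ (e.left_inv hy.2)]
  have := AlternatingMap.map_eq_sum_basis B
    ((α (e.symm (e (φ y)))).compLinearMap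
      (mfderiv 𝓘(ℂ, E) 𝓘(ℂ, E) e.symm (e (φ y))).toLinearMap)
    (fun i => fderiv ℂ (e ∘ φ) y (v i))
  refine Eq.trans ?_ this
  refine congrArg (α (e.symm (e (φ y)))) (funext fun i => ?_)
  exact hd (v i)

theorem isHolForm_of_param {U : Set N} (hU : IsOpen U) {α : Form E N k}
    (h : ∀ (V : Set E) (φ : E → N), IsOpen V → ContMDiffOn 𝓘(ℂ, E) 𝓘(ℂ, E) ω φ V → MapsTo φ V U →
      ∀ v : Fin k → E,
        ContDiffOn ℂ ω (fun y => α (φ y) (fun i => mfderiv 𝓘(ℂ, E) 𝓘(ℂ, E) φ y (v i))) V) :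
    IsHolForm U α :=
  fun p v => h _ _ (isOpen_chart_target_inter_preimage (E := E) hU p)
    ((contMDiffOn_chart_symm (I := 𝓘(ℂ, E)) (x := p)).mono inter_subset_left) (fun _ hy => hy.2) v

/-- A parametrization of `N` followed by `f` is a holomorphic map into `N'`, in general no local
isomorphism, and `contDiffOn_param` allows exactly such maps. -/
theorem IsHolForm.pullback {E' : Type*} [NormedAddCommGroup E'] [NormedSpace ℂ E']
    [FiniteDimensional ℂ E'] {N' : Type*} [TopologicalSpace N'] [ChartedSpace E' N']
    [IsManifold 𝓘(ℂ, E') ω N'] {f : N → N'} (hf : ContMDiff 𝓘(ℂ, E) 𝓘(ℂ, E') ω f)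
    {W : Set N} (hW : IsOpen W) {U : Set N'} (hWU : MapsTo f W U) {α : Form E' N' k}
    (h : IsHolForm U α) : IsHolForm W (fun p => pullbackAt (E := E) (E' := E') f p (α (f p))) := by
  refine isHolForm_of_param hW fun V φ hV hφ hVW v => ?_
  refine (h.contDiffOn_param hV (hf.comp_contMDiffOn hφ) (hWU.comp hVW) v).congr fun y hy => ?_
  have h1 : MDifferentiableAt 𝓘(ℂ, E) 𝓘(ℂ, E) φ y :=
    ((hφ y hy).contMDiffAt (hV.mem_nhds hy)).mdifferentiableAt (by simp)
  have h2 : MDifferentiableAt 𝓘(ℂ, E) 𝓘(ℂ, E') f (φ y) := hf.mdifferentiableAt (by simp)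
  refine congrArg (α (f (φ y))) (funext fun i => ?_)
  rw [mfderiv_comp y h2 h1]
  rfl

/-- Near a point, `f` is the quotient of the coefficients of `f α` and `α` on constant vectors where
the latter does not vanish. -/
theorem IsHolForm.contMDiffOn_of_smul {U : Set N} (hU : IsOpen U) {α : Form E N k}
    (hα : IsHolForm U α) (hα0 : ∀ p ∈ U, α p ≠ 0) {f : N → ℂ}
    (hf : IsHolForm U (fun p => f p • α p)) : ContMDiffOn 𝓘(ℂ, E) 𝓘(ℂ, ℂ) ω f U := by
  intro p hp
  set e := chartAt E p with he
  have hep : e p ∈ e.target := e.map_source (mem_chart_source E p)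
  have hpp : e.symm (e p) = p := e.left_inv (mem_chart_source E p)
  have hepU : e p ∈ e.target ∩ e.symm ⁻¹' U := ⟨hep, by
    change e.symm (e p) ∈ U
    rwa [hpp]⟩
  have hsurj : Function.Surjective (mfderiv 𝓘(ℂ, E) 𝓘(ℂ, E) e.symm (e p)) :=
    (mdifferentiable_chart (I := 𝓘(ℂ, E)) p).symm.mfderiv_surjective hep
  have hne : α (e.symm (e p)) ≠ 0 := hα0 _ hepU.2
  obtain ⟨w, hw⟩ : ∃ w, α (e.symm (e p)) w ≠ 0 := by
    by_contra! hcon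
    exact hne (AlternatingMap.ext hcon)
  choose v hv using fun i => hsurj (w i)
  have hopen := isOpen_chart_target_inter_preimage hU p (E := E)
  have c1 := (hα p v).contDiffAt (hopen.mem_nhds hepU)
  have c2 := (hf p v).contDiffAt (hopen.mem_nhds hepU)
  have hw' : α (e.symm (e p)) (fun i => mfderiv 𝓘(ℂ, E) 𝓘(ℂ, E) e.symm (e p) (v i)) ≠ 0 := by
    simpa only [hv] using hw
  have c3 := c2.div c1 hw'
  have hchart : ContMDiffAt 𝓘(ℂ, E) 𝓘(ℂ, E) ω e p :=
    (contMDiffOn_chart (I := 𝓘(ℂ, E)) (x := p)).contMDiffAt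
      (e.open_source.mem_nhds (mem_chart_source E p))
  refine ((c3.contMDiffAt.comp p hchart).congr_of_eventuallyEq ?_).contMDiffWithinAt
  have hnear : ∀ᶠ y in 𝓝 p,
      α (e.symm (e y)) (fun i => mfderiv 𝓘(ℂ, E) 𝓘(ℂ, E) e.symm (e y) (v i)) ≠ 0 :=
    (c1.continuousAt.comp hchart.continuousAt).eventually_ne hw'
  filter_upwards [hnear, e.open_source.mem_nhds (mem_chart_source E p)] with y hy hys
  calc f y = f (e.symm (e y)) := by rw [e.left_inv hys]
    _ = _ := (mul_div_cancel_right₀ (f (e.symm (e y))) hy).symm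

end HolomorphicForms

/-! ### Linear algebra of interior multiplication -/

section InteriorMultiplication

universe u

/-- The position of the arguments of the original form in an iterated interior product. -/
theorem exists_interiorIter_apply (n q : ℕ) : ∃ e : Fin q ⊕ Fin n ≃ Fin (n + q),
    ∀ (V : Type u) [AddCommGroup V] [Module ℂ V] (v : Fin q → V) (α : V [⋀^Fin (n + q)]→ₗ[ℂ] ℂ)
      (w : Fin n → V), interiorIter q v α w = α (Sum.elim v w ∘ e.symm) := by
  induction q with
  | zero =>
    refine ⟨Equiv.emptySum _ _, fun V _ _ v α w => ?_⟩
    change α w = _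
    refine congrArg α (funext fun i => ?_)
    simp
  | succ q ih =>
    obtain ⟨e, he⟩ := ih
    -- The last vector is contracted first, so it occupies slot `0` of `α`; the other arguments are
    -- placed by `e` in the successor slots.
    let e₁ : Fin (q + 1) ⊕ Fin n ≃ Option (Fin q ⊕ Fin n) :=
      ((finSuccEquivLast (n := q)).sumCongr (Equiv.refl _)).trans
        { toFun := Sum.elim (fun o => o.map Sum.inl) (fun i => some (Sum.inr i))
          invFun := fun o => o.elim (Sum.inl none) (Sum.elim (fun i => Sum.inl (some i)) Sum.inr)
          left_inv := by rintro ((_ | _) | _) <;> rfl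
          right_inv := by rintro (_ | _ | _) <;> rfl }
    let e₂ : Fin (q + 1) ⊕ Fin n ≃ Fin (n + q + 1) :=
      (e₁.trans e.optionCongr).trans (finSuccEquiv (n + q)).symm
    refine ⟨e₂, fun V _ _ v α w => ?_⟩
    change interiorIter q (fun i => v i.castSucc) (AlternatingMap.curryLeft α (v (Fin.last q))) w
      = _
    rw [he]
    refine congrArg (fun z => α z) (?_ : Matrix.vecCons _ _ = _)
    funext i
    refine Fin.cases ?_ (fun j => ?_) i
    · have : e₂.symm 0 = Sum.inl (Fin.last q) := by
        rw [Equiv.symm_apply_eq]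
        simp [e₂, e₁]
      simp [this]
    · have : e₂.symm j.succ = Sum.elim (fun i => Sum.inl i.castSucc) Sum.inr (e.symm j) := by
        obtain ⟨a, rfl⟩ := e.surjective j
        rw [Equiv.symm_apply_eq]
        rcases a with a | a <;> simp [e₂, e₁]
      rw [Function.comp_apply, this]
      rcases h : e.symm j with a | a <;> simp [h]

variable {V : Type*} [AddCommGroup V] [Module ℂ V] {n q : ℕ}

/-- The contracted vectors together with `w` are linearly dependent, and an alternating form
vanishes on such a family. -/
theorem interiorIter_eq_zero_of_mem_span {v : Fin q → V} (α : V [⋀^Fin (n + q)]→ₗ[ℂ] ℂ)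
    {w : Fin n → V} {i : Fin n} (hw : w i ∈ Submodule.span ℂ (range v)) :
    interiorIter q v α w = 0 := by
  obtain ⟨e, he⟩ := exists_interiorIter_apply n q
  rw [he]
  refine α.map_linearDependent _ fun hli => ?_
  have h1 : LinearIndependent ℂ (Sum.elim v w) := by
    rwa [linearIndependent_equiv] at hli
  have h2 := (linearIndependent_sum.1 h1).2.2
  have h3 := Submodule.disjoint_def.1 h2 (w i) (by simpa using hw)
    (Submodule.subset_span ⟨i, by simp⟩)
  exact h1.ne_zero (Sum.inr i) (by simpa using h3)

theorem interiorMul_interiorIter_eq_zero {v : Fin q → V} (α : V [⋀^Fin (n + q)]→ₗ[ℂ] ℂ) {x : V}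
    (hx : x ∈ Submodule.span ℂ (range v)) : interiorMul x (interiorIter q v α) = 0 := by
  cases n with
  | zero => rfl
  | succ n =>
    ext w
    change interiorIter q v α (Matrix.vecCons x w) = 0
    exact interiorIter_eq_zero_of_mem_span α (i := 0) (by simpa using hx)

theorem interiorMul_smul (x : V) (c : ℂ) (α : V [⋀^Fin n]→ₗ[ℂ] ℂ) :
    interiorMul x (c • α) = c • interiorMul x α := by
  cases n with
  | zero => exact (smul_zero c).symm
  | succ n => rfl

theorem interiorIter_smul (v : Fin q → V) (c : ℂ) (α : V [⋀^Fin (n + q)]→ₗ[ℂ] ℂ) :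
    interiorIter q v (c • α) = c • interiorIter q v α := by
  obtain ⟨e, he⟩ := exists_interiorIter_apply n q
  ext w
  rw [AlternatingMap.smul_apply, he, he]
  rfl

theorem interiorIter_compLinearMap {W : Type*} [AddCommGroup W] [Module ℂ W] (f : V →ₗ[ℂ] W)
    (v : Fin q → V) (α : W [⋀^Fin (n + q)]→ₗ[ℂ] ℂ) :
    interiorIter q v (α.compLinearMap f)
      = (interiorIter q (fun i => f (v i)) α).compLinearMap f := by
  induction q generalizing n with
  | zero => rfl
  | succ q ih =>
    change interiorIter q _ ((α.compLinearMap f).curryLeft (v (Fin.last q))) = _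
    rw [AlternatingMap.curryLeft_compLinearMap, ih]
    rfl

/-- A basis of a complement of the span completes `v` to a basis of `V`, on which a nonzero top form
cannot vanish. -/
theorem interiorIter_ne_zero [FiniteDimensional ℂ V] {v : Fin q → V}
    (hv : LinearIndependent ℂ v) (hV : Module.finrank ℂ V = n + q)
    {α : V [⋀^Fin (n + q)]→ₗ[ℂ] ℂ} (hα : α ≠ 0) : interiorIter q v α ≠ 0 := by
  classical
  obtain ⟨e, he⟩ := exists_interiorIter_apply n q
  obtain ⟨C, hC⟩ := (Submodule.span ℂ (range v)).exists_isCompl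
  have h1 : Module.finrank ℂ (Submodule.span ℂ (range v)) = q := by
    rw [finrank_span_eq_card hv, Fintype.card_fin]
  have h2 : Module.finrank ℂ C = n := by
    have := Submodule.finrank_add_eq_of_isCompl hC
    omega
  let w : Fin n → V := fun i => (Module.finBasisOfFinrankEq ℂ C h2 i : V)
  have hw : LinearIndependent ℂ w :=
    (Module.finBasisOfFinrankEq ℂ C h2).linearIndependent.map' C.subtype C.ker_subtype
  have hwC : Submodule.span ℂ (range w) ≤ C := by
    rw [Submodule.span_le]
    rintro _ ⟨i, rfl⟩
    exact Subtype.coe_prop _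
  have hli : LinearIndependent ℂ (Sum.elim v w) := hv.sum_type hw (hC.disjoint.mono_right hwC)
  have hli' : LinearIndependent ℂ (Sum.elim v w ∘ e.symm) := by
    rwa [linearIndependent_equiv]
  let B := Module.Basis.mk hli'
    (hli'.span_eq_top_of_card_eq_finrank' (by simp [hV])).ge
  intro h0
  apply (α.map_basis_ne_zero_iff B).2 hα
  rw [Module.Basis.coe_mk, ← he, h0]
  rfl

/-- If the contracted vectors come from a `q`-dimensional space, an endomorphism of that space
multiplies the iterated interior product by its determinant. -/
theorem interiorIter_map_det {K : Type*} [AddCommGroup K] [Module ℂ K] [FiniteDimensional ℂ K]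
    (hK : Module.finrank ℂ K = q) (ξ : K →ₗ[ℂ] V) (A : K →ₗ[ℂ] K) (x : Fin q → K)
    (α : V [⋀^Fin (n + q)]→ₗ[ℂ] ℂ) :
    interiorIter q (fun i => ξ (A (x i))) α
      = LinearMap.det A • interiorIter q (fun i => ξ (x i)) α := by
  obtain ⟨e, he⟩ := exists_interiorIter_apply n q
  ext w
  -- With `w` fixed, the value is an alternating `q`-form on the `q`-dimensional space `K`, hence a
  -- multiple of the determinant in a basis.
  let β : K [⋀^Fin q]→ₗ[ℂ] ℂ :=
    { toFun := fun y => α.domDomCongr e.symm (Sum.elim (fun i => ξ (y i)) w)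
      map_update_add' := by
        intro _ y i a c
        have h (c : K) : Sum.elim (fun j => ξ (Function.update y i c j)) w
            = Function.update (Sum.elim (fun j => ξ (y j)) w) (Sum.inl i) (ξ c) := by
          rw [Sum.update_elim_inl]
          congr 1
          funext j
          rcases eq_or_ne j i with rfl | hj <;> simp [*]
        rw [h, h, h, map_add, AlternatingMap.map_update_add]
      map_update_smul' := by
        intro _ y i a c
        have h (c : K) : Sum.elim (fun j => ξ (Function.update y i c j)) w
            = Function.update (Sum.elim (fun j => ξ (y j)) w) (Sum.inl i) (ξ c) := by
          rw [Sum.update_elim_inl]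
          congr 1
          funext j
          rcases eq_or_ne j i with rfl | hj <;> simp [*]
        rw [h, h, map_smul, AlternatingMap.map_update_smul]
      map_eq_zero_of_eq' := by
        intro y i j hij hne
        exact (α.domDomCongr e.symm).map_eq_zero_of_eq _ (i := Sum.inl i) (j := Sum.inl j)
          (by simp [hij]) (by simpa using hne) }
  have hβ : ∀ y : Fin q → K, interiorIter q (fun i => ξ (y i)) α w = β y := fun y => he _ _ _ _
  let B := Module.finBasisOfFinrankEq ℂ K hK
  rw [AlternatingMap.smul_apply, hβ, hβ, β.eq_smul_basis_det B, AlternatingMap.smul_apply,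
    AlternatingMap.smul_apply, show (fun i => A (x i)) = A ∘ x from rfl, B.det_comp]
  simp only [smul_eq_mul]
  ring

/-- Linear model of the transformation law of `Ω`: `l` is the differential of `h`, `A` is `Ad h`,
`c` is the value of `χM`, and `ξ`, `ξ'` are the vertical fields at `m` and `h • m`. -/
theorem interiorIter_eq_smul_compLinearMap {K W : Type*} [AddCommGroup K] [Module ℂ K]
    [FiniteDimensional ℂ K] [AddCommGroup W] [Module ℂ W] (hK : Module.finrank ℂ K = q)
    {ξ : K →ₗ[ℂ] V} {ξ' : K →ₗ[ℂ] W} {A : K →ₗ[ℂ] K} {l : V →ₗ[ℂ] W} {x : Fin q → K}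
    (hl : ∀ i, l (ξ (x i)) = ξ' (A (x i))) {c : ℂ} {α : V [⋀^Fin (n + q)]→ₗ[ℂ] ℂ}
    {β : W [⋀^Fin (n + q)]→ₗ[ℂ] ℂ} (hαβ : α = c • β.compLinearMap l) :
    interiorIter q (fun i => ξ (x i)) α
      = (c * LinearMap.det A) • (interiorIter q (fun i => ξ' (x i)) β).compLinearMap l := by
  rw [hαβ, interiorIter_smul, interiorIter_compLinearMap, funext hl, interiorIter_map_det hK,
    mul_smul]
  rfl

/-- An alternating form killed by the kernel of `p` does not see the projection `r ∘ p`, `r` being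
a section of `p`. -/
theorem AlternatingMap.compLinearMap_section {W : Type*} [AddCommGroup W] [Module ℂ W]
    {p : V →ₗ[ℂ] W} {r : W →ₗ[ℂ] V} (hpr : p ∘ₗ r = LinearMap.id) (α : V [⋀^Fin n]→ₗ[ℂ] ℂ)
    (hα : ∀ (w : Fin n → V) (i : Fin n), p (w i) = 0 → α w = 0) :
    (α.compLinearMap r).compLinearMap p = α := by
  classical
  ext v
  change α (fun i => r (p (v i))) = α v
  -- The second summand lies in the kernel of `p`, so in the multilinear expansion over subsets only
  -- the full subset survives.
  have h : v = (fun i => r (p (v i))) + fun i => v i - r (p (v i)) := by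
    funext i
    simp
  conv_rhs => rw [h, ← AlternatingMap.coe_multilinearMap, MultilinearMap.map_add_univ]
  rw [Finset.sum_eq_single Finset.univ]
  · simp
  · intro s _ hs
    obtain ⟨i, hi⟩ : ∃ i, i ∉ s := by
      by_contra! hcon
      exact hs (Finset.eq_univ_iff_forall.2 hcon)
    refine hα _ i ?_
    rw [Finset.piecewise_eq_of_notMem _ _ _ hi, map_sub]
    have := LinearMap.congr_fun hpr (p (v i))
    simp only [LinearMap.comp_apply, LinearMap.id_apply] at this
    rw [this, sub_self]
  · simp

/-- Forms of degree `dim V` are proportional. -/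
theorem AlternatingMap.exists_eq_smul_of_finrank_eq [FiniteDimensional ℂ V]
    (hV : Module.finrank ℂ V = n) {β : V [⋀^Fin n]→ₗ[ℂ] ℂ} (hβ : β ≠ 0)
    (α : V [⋀^Fin n]→ₗ[ℂ] ℂ) : ∃ c : ℂ, α = c • β := by
  let B := Module.finBasisOfFinrankEq ℂ V hV
  have h := (β.map_basis_ne_zero_iff B).2 hβ
  refine ⟨α B / β B, ?_⟩
  calc α = α B • B.det := α.eq_smul_basis_det B
    _ = (α B / β B) • β B • B.det := by rw [smul_smul, div_mul_cancel₀ _ h]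
    _ = (α B / β B) • β := by rw [← β.eq_smul_basis_det B]

end InteriorMultiplication

/-! ### Geometry of the principal bundle -/

/-- The chain rule for a composition whose intermediate point is only propositionally known. -/
theorem mfderiv_comp_apply_of_apply_eq {E E' E'' N N' N'' : Type*}
    [NormedAddCommGroup E] [NormedSpace ℂ E] [NormedAddCommGroup E'] [NormedSpace ℂ E']
    [NormedAddCommGroup E''] [NormedSpace ℂ E''] [TopologicalSpace N] [ChartedSpace E N]
    [TopologicalSpace N'] [ChartedSpace E' N'] [TopologicalSpace N''] [ChartedSpace E'' N'']
    {f : N → N'} {g : N' → N''} {x : N} {y : N'} (hy : f x = y)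
    (hg : MDifferentiableAt 𝓘(ℂ, E') 𝓘(ℂ, E'') g y) (hf : MDifferentiableAt 𝓘(ℂ, E) 𝓘(ℂ, E') f x)
    (v : E) : (mfderiv 𝓘(ℂ, E) 𝓘(ℂ, E'') (g ∘ f) x v : E'')
      = (mfderiv 𝓘(ℂ, E') 𝓘(ℂ, E'') g y (mfderiv 𝓘(ℂ, E) 𝓘(ℂ, E') f x v : E') : E'') := by
  subst hy
  rw [mfderiv_comp x hg hf]
  rfl

theorem gammaForm_inv {E N A : Type*} [NormedAddCommGroup E] [NormedSpace ℂ E]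
    [TopologicalSpace N] [ChartedSpace E N] [Group A] [MulAction A N] {k : ℕ} (a : A)
    (α : Form E N k) (p : N) :
    gammaForm a⁻¹ α p = pullbackAt (E := E) (E' := E) (fun p' : N => a • p') p (α (a • p)) := by
  have h : ∀ c : A, c = a → pullbackAt (E := E) (E' := E) (fun p' : N => c • p') p (α (c • p))
      = pullbackAt (E := E) (E' := E) (fun p' : N => a • p') p (α (a • p)) := by
    rintro c rfl
    rfl
  exact h _ (inv_inv a)

namespace EquivPrincipalBundle

variable
    {EG : Type*} [NormedAddCommGroup EG] [NormedSpace ℂ EG]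
    {EH : Type*} [NormedAddCommGroup EH] [NormedSpace ℂ EH]
    {EM : Type*} [NormedAddCommGroup EM] [NormedSpace ℂ EM]
    {EX : Type*} [NormedAddCommGroup EX] [NormedSpace ℂ EX]
    {G : Type*} [Group G] [TopologicalSpace G] [ChartedSpace EG G]
    {H : Type*} [Group H] [TopologicalSpace H] [ChartedSpace EH H]
    {M : Type*} [TopologicalSpace M] [ChartedSpace EM M]
    {X : Type*} [TopologicalSpace X] [ChartedSpace EX X]
    [MulAction G M] [MulAction H M] [MulAction G X] [SMulCommClass G H M]
    (P : EquivPrincipalBundle EG EH EM EX G H M X)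

include P in
theorem contMDiff_smul_G (g : G) : ContMDiff 𝓘(ℂ, EM) 𝓘(ℂ, EM) ω (fun m : M => g • m) :=
  P.holo_G.comp (contMDiff_const.prodMk contMDiff_id)

include P in
theorem contMDiff_smul_H (h : H) : ContMDiff 𝓘(ℂ, EM) 𝓘(ℂ, EM) ω (fun m : M => h • m) :=
  P.holo_H.comp (contMDiff_const.prodMk contMDiff_id)

include P in
theorem contMDiff_smul_base (g : G) : ContMDiff 𝓘(ℂ, EX) 𝓘(ℂ, EX) ω (fun x : X => g • x) :=
  P.holo_G_base.comp (contMDiff_const.prodMk contMDiff_id)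

/-- A trivializing section is translated by the fixed group element `c m`. -/
theorem exists_section_through (m : M) : ∃ (U : Set X) (s : X → M), IsOpen U ∧ P.proj m ∈ U ∧
    ContMDiffOn 𝓘(ℂ, EX) 𝓘(ℂ, EM) ω s U ∧ (∀ x ∈ U, P.proj (s x) = x) ∧ s (P.proj m) = m := by
  obtain ⟨U, hU, hx, s, c, hs, -, hps, hcs, -⟩ := P.locTriv (P.proj m)
  exact ⟨U, fun x => c m • s x, hU, hx, (P.contMDiff_smul_H (c m)).comp_contMDiffOn hs,
    fun x hxU => by rw [P.proj_H, hps x hxU], hcs m hx⟩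

theorem isOpenMap_proj : IsOpenMap P.proj := by
  intro W hW
  rw [isOpen_iff_mem_nhds]
  rintro _ ⟨m, hm, rfl⟩
  obtain ⟨U, s, hU, hx, hs, hps, hsm⟩ := P.exists_section_through m
  refine Filter.mem_of_superset ((hs.continuousOn.isOpen_inter_preimage hU hW).mem_nhds
    ⟨hx, ?_⟩) fun x hxU => ⟨s x, hxU.2, hps x hxU.1⟩
  change s (P.proj m) ∈ W
  rwa [hsm]

/-- The differential of a local section through `m` serves: the projection is a submersion. -/
theorem exists_rightInverse_mfderiv_proj (m : M) :
    ∃ r : EX →ₗ[ℂ] EM, ∀ v : EX, (mfderiv 𝓘(ℂ, EM) 𝓘(ℂ, EX) P.proj m (r v : EM) : EX) = v := by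
  obtain ⟨U, s, hU, hx, hs, hps, hsm⟩ := P.exists_section_through m
  refine ⟨(mfderiv 𝓘(ℂ, EX) 𝓘(ℂ, EM) s (P.proj m) : EX →L[ℂ] EM).toLinearMap, fun v => ?_⟩
  refine (mfderiv_comp_apply_of_apply_eq hsm (P.holo_proj.mdifferentiableAt (by simp))
    ((hs.contMDiffAt (hU.mem_nhds hx)).mdifferentiableAt (by simp)) v).symm.trans ?_
  have h : P.proj ∘ s =ᶠ[𝓝 (P.proj m)] id := by
    filter_upwards [hU.mem_nhds hx] with x hxU
    exact hps x hxU
  rw [h.mfderiv_eq, mfderiv_id]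
  rfl

theorem pullbackAt_proj_injective {d : ℕ} (m : M) {κ κ' : FormAt EX d (P.proj m)}
    (h : pullbackAt (E := EM) (E' := EX) P.proj m κ = pullbackAt (E := EM) P.proj m κ') :
    κ = κ' := by
  obtain ⟨r, hr⟩ := P.exists_rightInverse_mfderiv_proj m
  refine AlternatingMap.ext fun v => ?_
  have h1 := AlternatingMap.congr_fun h (fun i => r (v i))
  have h2 : (fun i => mfderiv 𝓘(ℂ, EM) 𝓘(ℂ, EX) P.proj m (r (v i))) = v :=
    funext fun i => hr (v i)
  change κ (fun i => mfderiv 𝓘(ℂ, EM) 𝓘(ℂ, EX) P.proj m (r (v i)))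
    = κ' (fun i => mfderiv 𝓘(ℂ, EM) 𝓘(ℂ, EX) P.proj m (r (v i))) at h1
  rwa [h2] at h1

/-! ### Fundamental vector fields and the vertical tangent space. -/

section LieGroup

variable [LieGroup 𝓘(ℂ, EH) ω H]

include P in
theorem contMDiff_orbit (m : M) :
    ContMDiff 𝓘(ℂ, EH) 𝓘(ℂ, EM) ω (fun h : H => h⁻¹ • m) :=
  P.holo_H.comp ((contMDiff_inv 𝓘(ℂ, EH) ω).prodMk contMDiff_const)

/-- The linear map `x ↦ (ξ_x)_m`. -/
noncomputable def vecFieldLin (_P : EquivPrincipalBundle EG EH EM EX G H M X) (m : M) : EH →ₗ[ℂ] EM :=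
  (mfderiv 𝓘(ℂ, EH) 𝓘(ℂ, EM) (fun h : H => h⁻¹ • m) 1 : EH →L[ℂ] EM).toLinearMap

theorem mfderiv_proj_vecField (x : EH) (m : M) :
    (mfderiv 𝓘(ℂ, EM) 𝓘(ℂ, EX) P.proj m (P.vecField (H := H) x m) : EX) = 0 := by
  have h := mfderiv_comp_apply_of_apply_eq (f := fun h : H => h⁻¹ • m) (x := 1) (by simp)
    (P.holo_proj.mdifferentiableAt (x := m) (by simp))
    ((P.contMDiff_orbit m).mdifferentiableAt (by simp)) x
  refine h.symm.trans ?_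
  have h' : P.proj ∘ (fun h : H => h⁻¹ • m) = fun _ => P.proj m := by
    funext h
    exact P.proj_H _ _
  rw [h', mfderiv_const]
  rfl

theorem mfderiv_smul_G_vecField (g : G) (x : EH) (m : M) :
    (mfderiv 𝓘(ℂ, EM) 𝓘(ℂ, EM) (fun m' : M => g • m') m (P.vecField (H := H) x m) : EM)
      = P.vecField (H := H) x (g • m) := by
  have h := mfderiv_comp_apply_of_apply_eq (f := fun h : H => h⁻¹ • m) (x := 1) (by simp)
    ((P.contMDiff_smul_G g).mdifferentiableAt (x := m) (by simp))
    ((P.contMDiff_orbit m).mdifferentiableAt (by simp)) x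
  refine h.symm.trans ?_
  have h' : (fun m' : M => g • m') ∘ (fun h : H => h⁻¹ • m) = fun h : H => h⁻¹ • g • m := by
    funext h
    exact smul_comm _ _ _
  rw [h']
  rfl

/-- Derivative at `k = 1` of the identity `h • k⁻¹ • m = (h * k * h⁻¹)⁻¹ • h • m`. -/
theorem mfderiv_smul_H_vecField (h : H) (x : EH) (m : M) :
    (mfderiv 𝓘(ℂ, EM) 𝓘(ℂ, EM) (fun m' : M => h • m') m (P.vecField (H := H) x m) : EM)
      = P.vecField (H := H)
          (mfderiv 𝓘(ℂ, EH) 𝓘(ℂ, EH) (fun k : H => h * k * h⁻¹) 1 x : EH) (h • m) := by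
  have hconj : ContMDiff 𝓘(ℂ, EH) 𝓘(ℂ, EH) ω (fun k : H => h * k * h⁻¹) :=
    (contMDiff_const.mul contMDiff_id).mul contMDiff_const
  have h1 := mfderiv_comp_apply_of_apply_eq (f := fun k : H => k⁻¹ • m) (x := 1) (by simp)
    ((P.contMDiff_smul_H h).mdifferentiableAt (x := m) (by simp))
    ((P.contMDiff_orbit m).mdifferentiableAt (by simp)) x
  have h2 := mfderiv_comp_apply_of_apply_eq (f := fun k : H => h * k * h⁻¹) (x := 1) (y := 1)
    (by simp) ((P.contMDiff_orbit (h • m)).mdifferentiableAt (by simp))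
    (hconj.mdifferentiableAt (by simp)) x
  refine h1.symm.trans (Eq.trans ?_ h2)
  have h' : (fun m' : M => h • m') ∘ (fun k : H => k⁻¹ • m)
      = (fun k : H => k⁻¹ • h • m) ∘ fun k : H => h * k * h⁻¹ := by
    funext k
    simp [← mul_smul, mul_assoc]
  rw [h']

/-- The orbit map `h ↦ h⁻¹ • m` has the left inverse `m' ↦ c m * (c m')⁻¹`, holomorphic near `m`. -/
theorem vecFieldLin_injective (m : M) : Function.Injective (P.vecFieldLin m) := by
  obtain ⟨U, hU, hx, s, c, -, hc, -, hcs, hch⟩ := P.locTriv (P.proj m)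
  have hopen : IsOpen (P.proj ⁻¹' U) := hU.preimage P.holo_proj.continuous
  have hF : MDifferentiableAt 𝓘(ℂ, EM) 𝓘(ℂ, EH) (fun m' : M => c m * (c m')⁻¹) m := by
    have h1 : ContMDiffAt 𝓘(ℂ, EM) 𝓘(ℂ, EH) ω c m := hc.contMDiffAt (hopen.mem_nhds hx)
    exact (contMDiffAt_const.mul h1.inv).mdifferentiableAt (by simp)
  have hcomp : (fun m' : M => c m * (c m')⁻¹) ∘ (fun h : H => h⁻¹ • m) = id := by
    funext h
    have h1 : h⁻¹ • m = (h⁻¹ * c m) • s (P.proj m) := by rw [mul_smul, hcs m hx]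
    simp only [Function.comp_apply, id]
    rw [h1, hch _ hx]
    group
  refine Function.LeftInverse.injective
    (g := (mfderiv 𝓘(ℂ, EM) 𝓘(ℂ, EH) (fun m' : M => c m * (c m')⁻¹) m : EM → EH)) fun x => ?_
  refine (mfderiv_comp_apply_of_apply_eq (f := fun h : H => h⁻¹ • m) (x := 1) (by simp) hF
    ((P.contMDiff_orbit m).mdifferentiableAt (by simp)) x).symm.trans ?_
  rw [hcomp, mfderiv_id]
  rfl

/-- The kernel of the submersion has dimension `(d + q) - d = q` and contains these `q` independent
vectors. -/
theorem mem_span_vecField [FiniteDimensional ℂ EH] [FiniteDimensional ℂ EM]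
    [FiniteDimensional ℂ EX] {d q : ℕ} (hd : Module.finrank ℂ EX = d)
    (hn : Module.finrank ℂ EM = d + q) {b : Fin q → TangentSpace 𝓘(ℂ, EH) (1 : H)}
    (hb : LinearIndependent ℂ b) (m : M) {v : TangentSpace 𝓘(ℂ, EM) m}
    (hv : mfderiv 𝓘(ℂ, EM) 𝓘(ℂ, EX) P.proj m v = 0) :
    v ∈ Submodule.span ℂ (range fun i => P.vecField (b i) m) := by
  let p : EM →ₗ[ℂ] EX := (mfderiv 𝓘(ℂ, EM) 𝓘(ℂ, EX) P.proj m : EM →L[ℂ] EX).toLinearMap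
  let B : Fin q → EM := fun i => P.vecFieldLin m (b i)
  have hB : LinearIndependent ℂ B :=
    LinearIndependent.map' (M := EH) (v := b) hb (P.vecFieldLin m)
      (LinearMap.ker_eq_bot.2 (P.vecFieldLin_injective m))
  have hle : Submodule.span ℂ (range B) ≤ LinearMap.ker p := by
    rw [Submodule.span_le]
    rintro _ ⟨i, rfl⟩
    exact P.mfderiv_proj_vecField (b i) m
  have hsurj : LinearMap.range p = ⊤ := by
    obtain ⟨r, hr⟩ := P.exists_rightInverse_mfderiv_proj m
    exact LinearMap.range_eq_top.2 fun x => ⟨r x, hr x⟩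
  have hker : Module.finrank ℂ (LinearMap.ker p) = q := by
    have := p.finrank_range_add_finrank_ker
    rw [hsurj, finrank_top] at this
    omega
  have heq := Submodule.eq_of_le_of_finrank_eq hle (by
    rw [finrank_span_eq_card hB, Fintype.card_fin, hker])
  change (v : EM) ∈ Submodule.span ℂ (range B)
  rw [heq]
  exact hv

/-! ### The contracted form `Ω`: descent, equivariance, holomorphy. -/

section Omega

variable {d q : ℕ} (ωM : Form EM M (d + q)) {b : Fin q → TangentSpace 𝓘(ℂ, EH) (1 : H)}

theorem interiorMul_vecField_Omega [FiniteDimensional ℂ EH] [FiniteDimensional ℂ EM]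
    [FiniteDimensional ℂ EX] (hd : Module.finrank ℂ EX = d)
    (hn : Module.finrank ℂ EM = d + q) (hb : LinearIndependent ℂ b)
    (x : TangentSpace 𝓘(ℂ, EH) (1 : H)) (m : M) :
    interiorMul (P.vecField x m) (P.Omega ωM b m) = 0 :=
  interiorMul_interiorIter_eq_zero _
    (P.mem_span_vecField hd hn hb m (P.mfderiv_proj_vecField x m))

theorem Omega_ne_zero [FiniteDimensional ℂ EM]
    (hn : Module.finrank ℂ EM = d + q) (hb : LinearIndependent ℂ b) {m : M} (hω : ωM m ≠ 0) :
    P.Omega ωM b m ≠ 0 := by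
  have hB : LinearIndependent ℂ (fun i => P.vecFieldLin m (b i)) :=
    LinearIndependent.map' (M := EH) (v := b) hb (P.vecFieldLin m)
      (LinearMap.ker_eq_bot.2 (P.vecFieldLin_injective m))
  exact interiorIter_ne_zero (V := EM) hB hn hω

theorem exists_pullbackAt_proj_eq_Omega [FiniteDimensional ℂ EH] [FiniteDimensional ℂ EM]
    [FiniteDimensional ℂ EX] (hd : Module.finrank ℂ EX = d)
    (hn : Module.finrank ℂ EM = d + q) (hb : LinearIndependent ℂ b) (m : M) :
    ∃ κ : FormAt EX d (P.proj m), pullbackAt (E := EM) P.proj m κ = P.Omega ωM b m := by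
  obtain ⟨r, hr⟩ := P.exists_rightInverse_mfderiv_proj m
  refine ⟨(P.Omega ωM b m).compLinearMap r, ?_⟩
  refine AlternatingMap.compLinearMap_section (V := EM) (W := EX) (n := d)
    (p := (mfderiv 𝓘(ℂ, EM) 𝓘(ℂ, EX) P.proj m : EM →L[ℂ] EX).toLinearMap) (r := r)
    (LinearMap.ext hr) (P.Omega ωM b m) fun w i hw => ?_
  exact interiorIter_eq_zero_of_mem_span (V := EM) (ωM m) (i := i)
    (P.mem_span_vecField hd hn hb m hw)

theorem gammaForm_Omega (g : G) (m : M) :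
    gammaForm g (P.Omega ωM b) m = P.Omega (gammaForm g ωM) b m := by
  symm
  refine (interiorIter_compLinearMap (V := EM) (W := EM)
    (mfderiv 𝓘(ℂ, EM) 𝓘(ℂ, EM) (fun m' : M => g⁻¹ • m') m : EM →L[ℂ] EM).toLinearMap
    (fun i => P.vecField (b i) m) (ωM (g⁻¹ • m))).trans ?_
  have h : (fun i => (mfderiv 𝓘(ℂ, EM) 𝓘(ℂ, EM) (fun m' : M => g⁻¹ • m') m
      (P.vecField (b i) m) : EM)) = fun i => P.vecField (b i) (g⁻¹ • m) :=
    funext fun i => P.mfderiv_smul_G_vecField g⁻¹ (b i) m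
  exact congrArg (fun v : Fin q → EM => (interiorIter q v (ωM (g⁻¹ • m))).compLinearMap
    (mfderiv 𝓘(ℂ, EM) 𝓘(ℂ, EM) (fun m' : M => g⁻¹ • m') m : EM →L[ℂ] EM).toLinearMap) h

theorem smul_pullbackAt_smul_Omega [FiniteDimensional ℂ EH] (hq : Module.finrank ℂ EH = q)
    {χM : H →* ℂˣ} (hω : ∀ (h : H) (m : M), gammaForm h ωM m = (χM h : ℂ) • ωM m)
    (h : H) (m : M) :
    ((χM h : ℂ) * detAd EH h) • pullbackAt (E := EM) (E' := EM) (fun m' : M => h • m') m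
      (P.Omega ωM b (h • m)) = P.Omega ωM b m := by
  let l : EM →ₗ[ℂ] EM :=
    (mfderiv 𝓘(ℂ, EM) 𝓘(ℂ, EM) (fun m' : M => h • m') m : EM →L[ℂ] EM).toLinearMap
  let A : EH →ₗ[ℂ] EH :=
    (mfderiv 𝓘(ℂ, EH) 𝓘(ℂ, EH) (fun k : H => h * k * h⁻¹) 1 : EH →L[ℂ] EH).toLinearMap
  -- The invariance of `ωM` is used for `h⁻¹`, since `Γ_{h⁻¹}` is pullback along `h`.
  have h1 : (ωM m : FormAt EM (d + q) m)
      = (χM h : ℂ) • pullbackAt (E := EM) (E' := EM) (fun m' : M => h • m') m (ωM (h • m)) := by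
    rw [← gammaForm_inv, hω, smul_smul, ← Units.val_mul, ← map_mul, mul_inv_cancel, map_one,
      Units.val_one, one_smul]
  exact (interiorIter_eq_smul_compLinearMap (V := EM) (W := EM) hq (ξ := P.vecFieldLin m)
    (ξ' := P.vecFieldLin (h • m)) (A := A) (l := l)
    (fun i => P.mfderiv_smul_H_vecField h (b i) m) h1).symm

variable [IsManifold 𝓘(ℂ, EM) ω M]

/-- Enlarging a parametrization by a group direction turns the vertical fields into images of
constant vectors, so a coefficient of `Ω` becomes one of `ωM` restricted to a slice. -/
theorem isHolForm_Omega [FiniteDimensional ℂ EM] (hω : IsHolForm univ ωM) :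
    IsHolForm univ (P.Omega ωM b) := by
  refine isHolForm_of_param isOpen_univ fun V φ hV hφ _ v => ?_
  obtain ⟨e, he⟩ := exists_interiorIter_apply d q
  let c := chartAt EH (1 : H)
  have hc : (1 : H) ∈ c.source := mem_chart_source EH 1
  have hc1 : c.symm (c 1) = 1 := c.left_inv hc
  have hcm : MDifferentiableAt 𝓘(ℂ, EH) 𝓘(ℂ, EH) c.symm (c 1) :=
    mdifferentiableAt_atlas_symm (chart_mem_atlas EH _) (c.map_source hc)
  have hsurj : Function.Surjective (mfderiv 𝓘(ℂ, EH) 𝓘(ℂ, EH) c.symm (c 1) : EH → EH) :=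
    (mdifferentiable_chart (I := 𝓘(ℂ, EH)) (1 : H)).symm.mfderiv_surjective (c.map_source hc)
  choose b' hb' using fun i => hsurj (b i)
  let Φ : EM × EH → M := fun z => (c.symm z.2)⁻¹ • φ z.1
  have hΦ : ContMDiffOn 𝓘(ℂ, EM × EH) 𝓘(ℂ, EM) ω Φ (V ×ˢ c.target) := by
    have h1 : ContMDiffOn 𝓘(ℂ, EM × EH) 𝓘(ℂ, EM) ω (fun z : EM × EH => φ z.1) (V ×ˢ c.target) :=
      hφ.comp contDiff_fst.contMDiff.contMDiffOn fun z hz => hz.1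
    have h2 : ContMDiffOn 𝓘(ℂ, EM × EH) 𝓘(ℂ, EH) ω (fun z : EM × EH => c.symm z.2)
        (V ×ˢ c.target) :=
      (contMDiffOn_chart_symm (I := 𝓘(ℂ, EH)) (x := (1 : H))).comp
        contDiff_snd.contMDiff.contMDiffOn fun z hz => hz.2
    exact P.holo_H.comp_contMDiffOn (h2.inv.prodMk h1)
  have hO : IsOpen (V ×ˢ c.target) := hV.prod c.open_target
  have h1 := hω.contDiffOn_param hO hΦ (mapsTo_univ _ _)
    -- On the slice `t = c 1`, the differential of `Φ` sends `(0, b' j)` to the field of `b j` and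
    -- `(w, 0)` to `dφ w`.
    (Sum.elim (fun j => ((0, b' j) : EM × EH)) (fun i => (v i, 0)) ∘ e.symm)
  have h2 : ContDiffOn ℂ ω (fun y : EM => (y, c 1)) V := (contDiff_prodMk_left (c 1)).contDiffOn
  refine (h1.comp h2 fun y hy => ⟨hy, c.map_source hc⟩).congr fun y hy => ?_
  have hΦy : Φ (y, c 1) = φ y := by simp [Φ, hc1]
  have hΦd : MDifferentiableAt 𝓘(ℂ, EM × EH) 𝓘(ℂ, EM) Φ (y, c 1) :=
    (hΦ.contMDiffAt (hO.mem_nhds ⟨hy, c.map_source hc⟩)).mdifferentiableAt (by simp)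
  have hvert : ∀ j, (mfderiv 𝓘(ℂ, EM × EH) 𝓘(ℂ, EM) Φ (y, c 1) ((0, b' j) : EM × EH) : EM)
      = P.vecField (b j) (φ y) := fun j => by
    have hr : HasFDerivAt (fun t : EH => (y, t)) (ContinuousLinearMap.inr ℂ EM EH) (c 1) :=
      hasFDerivAt_prodMk_right y (c 1)
    have k1 := mfderiv_comp_apply_of_apply_eq (f := fun t : EH => (y, t)) (x := c 1) rfl hΦd
      hr.differentiableAt.mdifferentiableAt (b' j)
    have k2 := mfderiv_comp_apply_of_apply_eq hc1
      ((P.contMDiff_orbit (φ y)).mdifferentiableAt (by simp)) hcm (b' j)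
    rw [mfderiv_eq_fderiv, hr.fderiv] at k1
    have k3 : (mfderiv 𝓘(ℂ, EH) 𝓘(ℂ, EM) (fun h : H => h⁻¹ • φ y) 1
        (mfderiv 𝓘(ℂ, EH) 𝓘(ℂ, EH) c.symm (c 1) (b' j) : EH) : EM)
        = P.vecField (b j) (φ y) := by
      rw [hb']
      rfl
    exact k1.symm.trans (k2.trans k3)
  have hhor : ∀ w : EM, (mfderiv 𝓘(ℂ, EM × EH) 𝓘(ℂ, EM) Φ (y, c 1) ((w, 0) : EM × EH) : EM)
      = mfderiv 𝓘(ℂ, EM) 𝓘(ℂ, EM) φ y w := fun w => by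
    have hr : HasFDerivAt (fun y' : EM => (y', c 1)) (ContinuousLinearMap.inl ℂ EM EH) y :=
      hasFDerivAt_prodMk_left y (c 1)
    have k1 := mfderiv_comp_apply_of_apply_eq (f := fun y' : EM => (y', c 1)) (x := y) rfl hΦd
      hr.differentiableAt.mdifferentiableAt w
    rw [mfderiv_eq_fderiv, hr.fderiv] at k1
    refine k1.symm.trans ?_
    have k2 : Φ ∘ (fun y' : EM => (y', c 1)) = φ := by
      funext y'
      simp [Φ, hc1]
    rw [k2]
  have hpt : ∀ (p : M) (u : Fin (d + q) → EM), p = φ y → ωM (φ y) u = ωM p u := by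
    rintro p u rfl
    rfl
  refine (he EM _ (ωM (φ y)) _).trans ((hpt _ _ hΦy).trans ?_)
  refine congrArg (ωM (Φ (y, c 1))) (funext fun i => ?_)
  simp only [Function.comp_apply]
  rcases e.symm i with j | j
  · exact (hvert j).symm
  · exact (hhor (v j)).symm

end Omega

end LieGroup

end EquivPrincipalBundle

namespace EquivPrincipalBundle

variable
    {EG : Type*} [NormedAddCommGroup EG] [NormedSpace ℂ EG]
    {EH : Type*} [NormedAddCommGroup EH] [NormedSpace ℂ EH]
    {EM : Type*} [NormedAddCommGroup EM] [NormedSpace ℂ EM]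
    {EX : Type*} [NormedAddCommGroup EX] [NormedSpace ℂ EX]
    {G : Type*} [Group G] [TopologicalSpace G] [ChartedSpace EG G]
    {H : Type*} [Group H] [TopologicalSpace H] [ChartedSpace EH H]
    {M : Type*} [TopologicalSpace M] [ChartedSpace EM M]
    {X : Type*} [TopologicalSpace X] [ChartedSpace EX X]
    [MulAction G M] [MulAction H M] [MulAction G X] [SMulCommClass G H M]
    (P : EquivPrincipalBundle EG EH EM EX G H M X) {χ : H →* ℂˣ}

/-! ### Coefficients in the frame of `L_χ` given by a point of `M` -/

theorem cls_smul_pt {x : X} {m m' : M} (hm : P.proj m = x) (hm' : P.proj m' = x) {h : H}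
    (hmm' : m' = h • m) (v : ℂ) : P.cls χ m' hm' (χ h * v) = P.cls χ m hm v :=
  Subtype.ext ((AssocLine.mk_eq_iff χ _ _ _ _).2 ⟨h, hmm', rfl⟩).symm

theorem cls_zero {x : X} (m : M) (hm : P.proj m = x) : P.cls χ m hm 0 = 0 := by
  simpa using P.cls_smul χ m hm 0 0

theorem cls_eq_zero_iff {x : X} (m : M) (hm : P.proj m = x) {v : ℂ} :
    P.cls χ m hm v = 0 ↔ v = 0 := by
  rw [← P.cls_zero m hm]
  exact (P.cls_bijective χ m hm).1.eq_iff

/-- The identification of `(L_χ)_x ⊗ W` with `W` given by a point of `M` above `x`. -/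
noncomputable def coeffEquiv (χ : H →* ℂˣ) (W : Type*) [AddCommGroup W] [Module ℂ W] {x : X}
    (m : M) (hm : P.proj m = x) : P.Fiber χ x ⊗[ℂ] W ≃ₗ[ℂ] W :=
  (TensorProduct.congr (LinearEquiv.ofBijective
    ({ toFun := P.cls χ m hm
       map_add' := P.cls_add χ m hm
       map_smul' := P.cls_smul χ m hm } : ℂ →ₗ[ℂ] P.Fiber χ x) (P.cls_bijective χ m hm)).symm
    (LinearEquiv.refl ℂ W)).trans (TensorProduct.lid ℂ W)

variable {W : Type*} [AddCommGroup W] [Module ℂ W]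

theorem coeffEquiv_cls_tmul {x : X} (m : M) (hm : P.proj m = x) (v : ℂ) (w : W) :
    P.coeffEquiv χ W m hm (P.cls χ m hm v ⊗ₜ w) = v • w := by
  rw [coeffEquiv, LinearEquiv.trans_apply, TensorProduct.congr_tmul, TensorProduct.lid_tmul]
  refine congrArg (· • w) ?_
  rw [LinearEquiv.symm_apply_eq]
  rfl

theorem cls_tmul_eq_iff {x : X} (m : M) (hm : P.proj m = x) {v v' : ℂ} {w w' : W} :
    P.cls χ m hm v ⊗ₜ[ℂ] w = P.cls χ m hm v' ⊗ₜ[ℂ] w' ↔ v • w = v' • w' := by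
  rw [← (P.coeffEquiv χ W m hm).injective.eq_iff, coeffEquiv_cls_tmul, coeffEquiv_cls_tmul]

theorem exists_eq_cls_one_tmul {x : X} (m : M) (hm : P.proj m = x) (t : P.Fiber χ x ⊗[ℂ] W) :
    ∃ w : W, t = P.cls χ m hm 1 ⊗ₜ w := by
  refine ⟨P.coeffEquiv χ W m hm t, (P.coeffEquiv χ W m hm).injective ?_⟩
  rw [coeffEquiv_cls_tmul, one_smul]

theorem actFiber_cls {g : G} {x : X} {m : M} (hm : P.proj m = x)
    (hm' : P.proj (g⁻¹ • m) = g⁻¹ • x) (v : ℂ) :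
    P.actFiber χ g x (P.cls χ (g⁻¹ • m) hm' v) = P.cls χ m hm v := by
  refine Subtype.ext ?_
  change AssocLine.mk χ (g • g⁻¹ • m) v = AssocLine.mk χ m v
  rw [smul_inv_smul]

/-! ### Functions representing sections of `L_χ` -/

theorem funOfSec_eq_iff {σ : P.Sec χ} {x : X} {m : M} (hx : P.proj m = x) {v : ℂ} :
    P.funOfSec χ σ m = v ↔ σ x = P.cls χ m hx v := by
  subst hx
  rw [← P.cls_funOfSec χ σ]
  exact (P.cls_bijective χ m rfl).1.eq_iff.symm

theorem funOfSec_ne_zero_iff {σ : P.Sec χ} {m : M} :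
    P.funOfSec χ σ m ≠ 0 ↔ σ (P.proj m) ≠ 0 := by
  rw [← P.cls_funOfSec χ σ, Ne, Ne, cls_eq_zero_iff]

theorem funOfSec_smul (σ : P.Sec χ) (h : H) (m : M) :
    P.funOfSec χ σ (h • m) = χ h * P.funOfSec χ σ m := by
  rw [P.funOfSec_eq_iff (P.proj_H h m), P.cls_smul_pt rfl _ rfl, P.cls_funOfSec]

theorem funOfSec_gammaSec (σ : P.Sec χ) (g : G) (m : M) :
    P.funOfSec χ (P.gammaSec χ g σ) m = P.funOfSec χ σ (g⁻¹ • m) := by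
  rw [P.funOfSec_eq_iff rfl]
  have h := (P.funOfSec_eq_iff (σ := σ) (P.proj_G g⁻¹ m)).1 rfl
  rw [gammaSec, h, P.actFiber_cls rfl]

/-- In a trivialization the function is `χ (c m) * f (P.proj m)`, with `f` the coefficient of `σ`.
-/
theorem contMDiff_funOfSec (hχ : IsHolCharacter EH χ) {σ : P.Sec χ} (hσ : P.IsHolSec χ σ) :
    ContMDiff 𝓘(ℂ, EM) 𝓘(ℂ, ℂ) ω (P.funOfSec χ σ) := by
  intro m
  obtain ⟨U, hU, hx, s, c, hs, hc, hps, hcs, -⟩ := P.locTriv (P.proj m)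
  obtain ⟨f, hf, hσf⟩ := hσ U s hU hs hps
  have hopen : IsOpen (P.proj ⁻¹' U) := hU.preimage P.holo_proj.continuous
  have h1 : ContMDiffOn 𝓘(ℂ, EM) 𝓘(ℂ, ℂ) ω (fun m' => (χ (c m') : ℂ) * f (P.proj m'))
      (P.proj ⁻¹' U) :=
    (hχ.comp_contMDiffOn hc).mul (hf.comp P.holo_proj.contMDiffOn fun _ h => h)
  refine (h1.contMDiffAt (hopen.mem_nhds hx)).congr_of_eventuallyEq ?_
  filter_upwards [hopen.mem_nhds hx] with m' hm'
  rw [P.funOfSec_eq_iff rfl, P.cls_smul_pt (hps _ hm') _ (hcs m' hm').symm, hσf _ hm']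

/-- The coefficient in the frame `s` is that of `σ` in the translated frame `x ↦ g⁻¹ • s (g • x)`,
composed with `g⁻¹`. -/
theorem isHolSec_gammaSec {σ : P.Sec χ} (hσ : P.IsHolSec χ σ) (g : G) :
    P.IsHolSec χ (P.gammaSec χ g σ) := by
  intro U s hU hs hps
  have hg := P.contMDiff_smul_base g
  obtain ⟨f, hf, hσf⟩ := hσ ((fun x => g • x) ⁻¹' U) (fun x => g⁻¹ • s (g • x))
    (hU.preimage hg.continuous)
    ((P.contMDiff_smul_G g⁻¹).comp_contMDiffOn (hs.comp hg.contMDiffOn fun _ h => h))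
    (fun x hx => by rw [P.proj_G, hps _ hx, inv_smul_smul])
  refine ⟨fun x => f (g⁻¹ • x), hf.comp (P.contMDiff_smul_base g⁻¹).contMDiffOn fun x hx => ?_,
    fun x hx => ?_⟩
  · simpa using hx
  · have h1 : g • g⁻¹ • x ∈ U := by simpa using hx
    have h2 : ∀ (m : M) (hm : P.proj m = g⁻¹ • x), m = g⁻¹ • s x →
        P.actFiber χ g x (P.cls χ m hm (f (g⁻¹ • x))) = P.cls χ (s x) (hps x hx) (f (g⁻¹ • x)) := by
      rintro _ hm rfl
      exact P.actFiber_cls (hps x hx) hm _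
    rw [gammaSec, hσf _ h1]
    exact h2 _ _ (by rw [smul_inv_smul])

/-- A nonzero holomorphic section of `L_χ` over a connected base vanishes on no open subset. -/
theorem exists_mem_ne_zero [ConnectedSpace X] [IsManifold 𝓘(ℂ, EX) ω X] {σ : P.Sec χ}
    (hσ : P.IsHolSec χ σ) (hσ0 : σ ≠ 0) {V : Set X} (hV : IsOpen V) (hVne : V.Nonempty) :
    ∃ x ∈ V, σ x ≠ 0 := by
  set Z : Set X := {x | σ x = 0} with hZ
  -- At a limit point, a chart ball meets `interior Z`; the coefficient of `σ` is analytic on this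
  -- connected ball and so vanishes on all of it.
  have hclosed : IsClosed (interior Z) := by
    refine isClosed_of_closure_subset fun x hx => ?_
    obtain ⟨U, hU, hxU, s, -, hs, -, hps, -, -⟩ := P.locTriv x
    obtain ⟨f, hf, hσf⟩ := hσ U s hU hs hps
    have hf0 : ∀ y ∈ U, (y ∈ Z ↔ f y = 0) := fun y hy => by
      rw [hZ, mem_ofPred_eq, hσf y hy, cls_eq_zero_iff]
    let e := chartAt EX x
    have hO := isOpen_chart_target_inter_preimage (E := EX) hU x
    have hex : e x ∈ e.target ∩ e.symm ⁻¹' U := ⟨mem_chart_target EX x, by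
      change e.symm (e x) ∈ U
      rwa [e.left_inv (mem_chart_source EX x)]⟩
    obtain ⟨r, hr, hball⟩ := Metric.isOpen_iff.1 hO _ hex
    have hfe : ContDiffOn ℂ ω (f ∘ e.symm) (Metric.ball (e x) r) :=
      contMDiffOn_iff_contDiffOn.1 <| hf.comp ((contMDiffOn_chart_symm (I := 𝓘(ℂ, EX))
        (x := x)).mono fun y hy => (hball hy).1) fun y hy => (hball hy).2
    have han : AnalyticOnNhd ℂ (f ∘ e.symm) (Metric.ball (e x) r) :=
      (Metric.isOpen_ball.analyticOn_iff_analyticOnNhd).1 (contDiffOn_omega_iff_analyticOn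
        Metric.isOpen_ball.uniqueDiffOn |>.1 hfe)
    have hB : IsOpen (e.source ∩ e ⁻¹' Metric.ball (e x) r) :=
      e.isOpen_inter_preimage Metric.isOpen_ball
    have hxB : x ∈ e.source ∩ e ⁻¹' Metric.ball (e x) r :=
      ⟨mem_chart_source EX x, Metric.mem_ball_self hr⟩
    obtain ⟨a, haB, haZ⟩ := mem_closure_iff.1 hx _ hB hxB
    have hea : e.symm (e a) = a := e.left_inv haB.1
    have hzero : (f ∘ e.symm) =ᶠ[𝓝 (e a)] 0 := by
      have hc : Filter.Tendsto e.symm (𝓝 (e a)) (𝓝 a) := by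
        have := (e.continuousAt_symm (e.map_source haB.1)).tendsto
        rwa [hea] at this
      filter_upwards [hc (isOpen_interior.mem_nhds haZ), Metric.isOpen_ball.mem_nhds haB.2]
        with y hy hyB
      exact (hf0 _ (hball hyB).2).1 (interior_subset hy)
    have hall := han.eqOn_zero_of_preconnected_of_eventuallyEq_zero
      (convex_ball (e x) r).isPreconnected haB.2 hzero
    refine mem_interior.2 ⟨_, fun y hy => ?_, hB, hxB⟩
    have h1 : e.symm (e y) = y := e.left_inv hy.1
    have h2 : f (e.symm (e y)) = 0 := hall hy.2
    have h3 : e.symm (e y) ∈ U := (hball hy.2).2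
    rw [h1] at h2 h3
    exact (hf0 y h3).2 h2
  rcases isClopen_iff.1 ⟨hclosed, isOpen_interior⟩ with h | h
  · by_contra! hcon
    obtain ⟨y, hy⟩ := hVne
    have : y ∈ interior Z := interior_maximal hcon hV hy
    rwa [h] at this
  · refine absurd (funext fun x => ?_) hσ0
    exact interior_subset (s := Z) (h ▸ mem_univ x)

/-! ### Functions representing sections of `L_χ ⊗ K_X` -/

section TopForms

variable {d : ℕ} {Ω : Form EM M d} {τ : P.SecK χ d}

/-- The frame at `m` trivializes the fibre of `L_χ` and pullback to `M` is injective, so the tensor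
identity can be tested on forms at `m`. -/
theorem representsAt_iff {m : M} (hΩ : ∃ κ : FormAt EX d (P.proj m), pullbackAt P.proj m κ = Ω m)
    {v c : ℂ} {κ : FormAt EX d (P.proj m)} (hτ : τ (P.proj m) = P.cls χ m rfl v ⊗ₜ κ) :
    P.RepresentsAt χ Ω τ m c ↔ c • Ω m = v • pullbackAt (E := EM) P.proj m κ := by
  constructor
  · rintro ⟨κ', hκ', hτ'⟩
    rw [hτ, cls_tmul_eq_iff] at hτ'
    rw [← hκ']
    exact (congrArg (pullbackAt (E := EM) P.proj m) hτ').symm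
  · intro h
    obtain ⟨κ', hκ'⟩ := hΩ
    refine ⟨κ', hκ', ?_⟩
    rw [hτ, cls_tmul_eq_iff]
    refine P.pullbackAt_proj_injective m ?_
    rw [← hκ'] at h
    exact h.symm

theorem exists_representsAt [FiniteDimensional ℂ EX] (hd : Module.finrank ℂ EX = d) {m : M}
    (hΩ : ∃ κ : FormAt EX d (P.proj m), pullbackAt P.proj m κ = Ω m) (hΩ0 : Ω m ≠ 0) :
    ∃ c, P.RepresentsAt χ Ω τ m c := by
  obtain ⟨κ, hκ⟩ := P.exists_eq_cls_one_tmul m rfl (τ (P.proj m))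
  obtain ⟨κ', hκ'⟩ := hΩ
  have hκ'0 : κ' ≠ 0 := by
    rintro rfl
    exact hΩ0 hκ'.symm
  obtain ⟨c, hc⟩ := AlternatingMap.exists_eq_smul_of_finrank_eq (V := EX) hd hκ'0 κ
  refine ⟨c, (P.representsAt_iff ⟨κ', hκ'⟩ hκ).2 ?_⟩
  rw [one_smul, ← hκ', hc]
  rfl

theorem funOfSecK_smul_eq [FiniteDimensional ℂ EX] (hd : Module.finrank ℂ EX = d) {m : M}
    (hΩ : ∃ κ : FormAt EX d (P.proj m), pullbackAt P.proj m κ = Ω m) (hΩ0 : Ω m ≠ 0)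
    {x : X} (hx : P.proj m = x) {v : ℂ} {κ : FormAt EX d x} (hτ : τ x = P.cls χ m hx v ⊗ₜ κ) :
    P.funOfSecK χ Ω τ m • Ω m = v • pullbackAt (E := EM) (E' := EX) P.proj m κ := by
  subst hx
  exact (P.representsAt_iff hΩ hτ).1 (Classical.epsilon_spec (P.exists_representsAt hd hΩ hΩ0))

theorem exists_eq_funOfSecK_tmul [FiniteDimensional ℂ EX] (hd : Module.finrank ℂ EX = d) {m : M}
    (hΩ : ∃ κ : FormAt EX d (P.proj m), pullbackAt P.proj m κ = Ω m) (hΩ0 : Ω m ≠ 0)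
    {x : X} (hx : P.proj m = x) : ∃ κ : FormAt EX d x,
      pullbackAt (E := EM) (E' := EX) P.proj m κ = Ω m ∧
      τ x = P.cls χ m hx (P.funOfSecK χ Ω τ m) ⊗ₜ κ := by
  subst hx
  exact Classical.epsilon_spec (P.exists_representsAt hd hΩ hΩ0)

theorem representsAt_unique {m : M} (hΩ0 : Ω m ≠ 0) {c c' : ℂ}
    (hc : P.RepresentsAt χ Ω τ m c) (hc' : P.RepresentsAt χ Ω τ m c') : c = c' := by
  obtain ⟨κ, hκ, hτ⟩ := hc
  rw [P.representsAt_iff ⟨κ, hκ⟩ hτ, hκ] at hc'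
  exact (smul_left_injective ℂ hΩ0 hc').symm

/-- Locally `τ_M Ω` equals `χ (c m)` times the pullback of the coefficient of `τ`; `Ω` has no zeros,
so it can be divided out. -/
theorem contMDiff_funOfSecK [FiniteDimensional ℂ EX] [IsManifold 𝓘(ℂ, EM) ω M]
    [IsManifold 𝓘(ℂ, EX) ω X] (hd : Module.finrank ℂ EX = d)
    (hΩ : ∀ m, ∃ κ : FormAt EX d (P.proj m), pullbackAt P.proj m κ = Ω m) (hΩ0 : ∀ m, Ω m ≠ 0)
    (hΩh : IsHolForm univ Ω) (hχ : IsHolCharacter EH χ) (hτ : P.IsHolSecK χ τ) :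
    ContMDiff 𝓘(ℂ, EM) 𝓘(ℂ, ℂ) ω (P.funOfSecK χ Ω τ) := by
  intro m
  obtain ⟨U, hU, hx, s, c, hs, hc, hps, hcs, -⟩ := P.locTriv (P.proj m)
  obtain ⟨κ, hκ, hτκ⟩ := hτ U s hU hs hps
  have hopen : IsOpen (P.proj ⁻¹' U) := hU.preimage P.holo_proj.continuous
  have h1 : IsHolForm (P.proj ⁻¹' U) (fun m' => (χ (c m') : ℂ) •
      pullbackAt (E := EM) (E' := EX) P.proj m' (κ (P.proj m'))) :=
    (hκ.pullback P.holo_proj hopen fun _ h => h).smul (hχ.comp_contMDiffOn hc)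
  refine ((hΩh.mono (subset_univ _)).contMDiffOn_of_smul hopen (fun m' _ => hΩ0 m')
    (h1.congr fun m' hm' => ?_)).contMDiffAt (hopen.mem_nhds hx)
  refine P.funOfSecK_smul_eq hd (hΩ m') (hΩ0 m') rfl ?_
  rw [hτκ _ hm', ← P.cls_smul_pt (hps _ hm') rfl (hcs m' hm').symm, mul_one]

/-- The point `m'` is kept separate because translated frames produce `g⁻¹ • s (g • g⁻¹ • x)`, equal
to `g⁻¹ • m` only propositionally. -/
theorem gammaSecK_apply_of_eq {g : G} {x : X} {m : M} (hm : P.proj m = x) {m' : M}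
    (hm'm : m' = g⁻¹ • m) (hm' : P.proj m' = g⁻¹ • x) {v : ℂ} {κ : FormAt EX d (g⁻¹ • x)}
    (hτ : τ (g⁻¹ • x) = P.cls χ m' hm' v ⊗ₜ κ) :
    P.gammaSecK χ g τ x = P.cls χ m hm v ⊗ₜ pullbackAt (fun y : X => g⁻¹ • y) x κ := by
  subst hm'm
  rw [gammaSecK, hτ, TensorProduct.map_tmul, P.actFiber_cls hm]
  rfl

theorem isHolSecK_gammaSecK [FiniteDimensional ℂ EX] [IsManifold 𝓘(ℂ, EX) ω X]
    (hτ : P.IsHolSecK χ τ) (g : G) : P.IsHolSecK χ (P.gammaSecK χ g τ) := by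
  intro U s hU hs hps
  have hg := P.contMDiff_smul_base g
  obtain ⟨κ, hκ, hτκ⟩ := hτ ((fun x => g • x) ⁻¹' U) (fun x => g⁻¹ • s (g • x))
    (hU.preimage hg.continuous)
    ((P.contMDiff_smul_G g⁻¹).comp_contMDiffOn (hs.comp hg.contMDiffOn fun _ h => h))
    (fun x hx => by rw [P.proj_G, hps _ hx, inv_smul_smul])
  refine ⟨gammaForm g κ, hκ.pullback (P.contMDiff_smul_base g⁻¹) hU fun x hx => ?_,
    fun x hx => ?_⟩
  · simpa using hx
  · exact P.gammaSecK_apply_of_eq (hps x hx) (by rw [smul_inv_smul]) _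
      (hτκ (g⁻¹ • x) (by simpa using hx))

/-- Follows from `P.proj` intertwining the two actions of `g⁻¹`; no invariance of `Ω` enters. -/
theorem funOfSecK_gammaSecK_smul [FiniteDimensional ℂ EX] (hd : Module.finrank ℂ EX = d)
    (hΩ : ∀ m, ∃ κ : FormAt EX d (P.proj m), pullbackAt P.proj m κ = Ω m) (hΩ0 : ∀ m, Ω m ≠ 0)
    (g : G) (m : M) :
    P.funOfSecK χ Ω (P.gammaSecK χ g τ) m • Ω m
      = P.funOfSecK χ Ω τ (g⁻¹ • m) • gammaForm g Ω m := by
  obtain ⟨κ, hκ, hτκ⟩ := P.exists_eq_funOfSecK_tmul (τ := τ) hd (hΩ (g⁻¹ • m)) (hΩ0 _)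
    (P.proj_G g⁻¹ m)
  rw [P.funOfSecK_smul_eq hd (hΩ m) (hΩ0 m) rfl (P.gammaSecK_apply_of_eq rfl rfl _ hτκ)]
  refine congrArg (P.funOfSecK χ Ω τ (g⁻¹ • m) • ·) ?_
  rw [gammaForm, ← hκ]
  refine AlternatingMap.ext fun v => congrArg κ (funext fun i => ?_)
  have h1 := mfderiv_comp_apply_of_apply_eq (f := P.proj) (x := m) rfl
    ((P.contMDiff_smul_base g⁻¹).mdifferentiableAt (x := P.proj m) (by simp))
    (P.holo_proj.mdifferentiableAt (by simp)) (v i)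
  have h2 := mfderiv_comp_apply_of_apply_eq (f := fun m : M => g⁻¹ • m) (x := m) rfl
    (P.holo_proj.mdifferentiableAt (x := g⁻¹ • m) (by simp))
    ((P.contMDiff_smul_G g⁻¹).mdifferentiableAt (x := m) (by simp)) (v i)
  refine h1.symm.trans (Eq.trans ?_ h2)
  have h3 : (fun y : X => g⁻¹ • y) ∘ P.proj = P.proj ∘ fun m : M => g⁻¹ • m :=
    funext fun m' => (P.proj_G g⁻¹ m').symm
  rw [h3]

theorem pullbackAt_smul_pullbackAt_proj (h : H) (m : M) (κ : EX [⋀^Fin d]→ₗ[ℂ] ℂ) :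
    pullbackAt (E := EM) (E' := EM) (fun m' : M => h • m') m
      (pullbackAt (E := EM) (E' := EX) P.proj (h • m) κ)
      = pullbackAt (E := EM) (E' := EX) P.proj m κ := by
  refine AlternatingMap.ext fun v => congrArg κ (funext fun i => ?_)
  refine (mfderiv_comp_apply_of_apply_eq (f := fun m : M => h • m) (x := m) rfl
    (P.holo_proj.mdifferentiableAt (x := h • m) (by simp))
    ((P.contMDiff_smul_H h).mdifferentiableAt (x := m) (by simp)) (v i)).symm.trans ?_
  have h3 : P.proj ∘ (fun m : M => h • m) = P.proj := funext (P.proj_H h)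
  rw [h3]
  rfl

theorem funOfSecK_smul [FiniteDimensional ℂ EX] (hd : Module.finrank ℂ EX = d)
    (hΩ : ∀ m, ∃ κ : FormAt EX d (P.proj m), pullbackAt P.proj m κ = Ω m) (hΩ0 : ∀ m, Ω m ≠ 0)
    {h : H} {m : M} {a : ℂ}
    (ha : a • pullbackAt (E := EM) (E' := EM) (fun m' : M => h • m') m (Ω (h • m)) = Ω m) :
    P.funOfSecK χ Ω τ (h • m) = χ h * a * P.funOfSecK χ Ω τ m := by
  obtain ⟨κ, hκ, hτκ⟩ := P.exists_eq_funOfSecK_tmul (τ := τ) hd (hΩ m) (hΩ0 m) rfl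
  obtain ⟨κ', hκ'⟩ := hΩ (h • m)
  -- The generators of `K_X` determined by `m` and by `h • m` differ by the factor `a`.
  have h1 : κ = a • (show FormAt EX d (P.proj m) from κ') := by
    refine P.pullbackAt_proj_injective m ?_
    rw [hκ, ← ha, ← hκ']
    exact congrArg (a • ·) (P.pullbackAt_smul_pullbackAt_proj h m κ')
  rw [← P.cls_smul_pt rfl (P.proj_H h m) rfl] at hτκ
  have h2 := P.funOfSecK_smul_eq hd (hΩ (h • m)) (hΩ0 _) (P.proj_H h m) hτκ
  have h3 : pullbackAt (E := EM) (E' := EX) P.proj (h • m) κ = a • Ω (h • m) := by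
    rw [h1, ← hκ']
    rfl
  rw [h3, smul_smul] at h2
  rw [smul_left_injective ℂ (hΩ0 (h • m)) h2]
  ring

end TopForms

/-! ### The residue form -/

section Residue

variable {d : ℕ}

/-- The quotient `τ / σ`, a `d`-form on `X` off the zeros of `σ`. -/
noncomputable def secQuotient (σ : P.Sec χ) (τ : P.SecK χ d) : Form EX X d :=
  fun x => Classical.epsilon fun κ => σ x ⊗ₜ[ℂ] κ = τ x

theorem tmul_secQuotient {σ : P.Sec χ} (τ : P.SecK χ d) {x : X} (hx : σ x ≠ 0) :
    σ x ⊗ₜ[ℂ] P.secQuotient σ τ x = τ x := by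
  refine Classical.epsilon_spec (p := fun κ => σ x ⊗ₜ[ℂ] κ = τ x) ?_
  obtain ⟨m, hm⟩ := P.exists_proj_eq x
  obtain ⟨v, hv⟩ := (P.cls_bijective χ m hm).2 (σ x)
  obtain ⟨κ, hκ⟩ := P.exists_eq_cls_one_tmul m hm (τ x)
  have hv0 : v ≠ 0 := by
    rintro rfl
    exact hx (hv.symm.trans (P.cls_zero m hm))
  refine ⟨v⁻¹ • κ, ?_⟩
  rw [hκ, ← hv, cls_tmul_eq_iff, smul_smul, mul_inv_cancel₀ hv0]

theorem smul_secQuotient {σ : P.Sec χ} {τ : P.SecK χ d} {x : X} (hx : σ x ≠ 0) {m : M}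
    (hm : P.proj m = x) {v : ℂ} {κ : FormAt EX d x} (hσ : σ x = P.cls χ m hm v)
    (hτ : τ x = P.cls χ m hm 1 ⊗ₜ κ) : v • P.secQuotient σ τ x = κ := by
  have h := P.tmul_secQuotient τ hx
  rw [hτ, hσ, cls_tmul_eq_iff, one_smul] at h
  exact h

/-- If `σ = [s, f]` and `τ = [s, 1] ⊗ κ`, the quotient is `κ / f`, and `κ` itself is the required
extension. -/
theorem isMeroAlong_secQuotient [ConnectedSpace X] [IsManifold 𝓘(ℂ, EX) ω X] {σ : P.Sec χ}
    (hσ : P.IsHolSec χ σ) (hσ0 : σ ≠ 0) {τ : P.SecK χ d} (hτ : P.IsHolSecK χ τ) :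
    P.IsMeroAlong χ σ (P.secQuotient σ τ) := by
  intro U s hU hs hps f hf
  obtain ⟨f', hf', hσf'⟩ := hσ U s hU hs hps
  obtain ⟨κ, hκ, hτκ⟩ := hτ U s hU hs hps
  have hff' : ∀ x ∈ U, f x = f' x := fun x hx =>
    (P.cls_bijective χ (s x) (hps x hx)).1 ((hf x hx).symm.trans (hσf' x hx))
  have hfh : ContMDiffOn 𝓘(ℂ, EX) 𝓘(ℂ, ℂ) ω f U := hf'.congr hff'
  have hne : ∀ x ∈ U, (σ x ≠ 0 ↔ f x ≠ 0) := fun x hx => by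
    rw [hf x hx, Ne, cls_eq_zero_iff]
  have hquot : ∀ x ∈ U, f x ≠ 0 → f x • P.secQuotient σ τ x = κ x := fun x hx hfx =>
    P.smul_secQuotient ((hne x hx).2 hfx) (hps x hx) (hf x hx) (hτκ x hx)
  refine ⟨hfh, fun x hx => mem_closure_iff.2 fun V hV hxV => ?_, ?_, κ, hκ, hquot⟩
  · obtain ⟨y, hy, hy0⟩ := P.exists_mem_ne_zero hσ hσ0 (hV.inter hU) ⟨x, hxV, hx⟩
    exact ⟨y, hy.1, hy.2, (hne y hy.2).1 hy0⟩
  · have h1 : ContMDiffOn 𝓘(ℂ, EX) 𝓘(ℂ, ℂ) ω (fun x => (f x)⁻¹) {x | x ∈ U ∧ f x ≠ 0} :=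
      (hfh.mono fun x hx => hx.1).inv₀ fun x hx => hx.2
    refine ((hκ.mono fun x hx => hx.1).smul h1).congr fun x hx => ?_
    rw [← hquot x hx.1 hx.2, smul_smul, inv_mul_cancel₀ hx.2, one_smul]

theorem isHolForm_secQuotient [ConnectedSpace X] [IsManifold 𝓘(ℂ, EX) ω X] {σ : P.Sec χ}
    (hσ : P.IsHolSec χ σ) (hσ0 : σ ≠ 0) {τ : P.SecK χ d} (hτ : P.IsHolSecK χ τ) :
    IsHolForm {x | σ x ≠ 0} (P.secQuotient σ τ) := by
  refine IsHolForm.of_locally fun x hx => ?_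
  obtain ⟨U, hU, hxU, s, -, hs, -, hps, -, -⟩ := P.locTriv x
  obtain ⟨f, hf, hσf⟩ := hσ U s hU hs hps
  refine ⟨{y | y ∈ U ∧ f y ≠ 0}, hf.continuousOn.isOpen_inter_preimage hU isOpen_ne, ⟨hxU, ?_⟩,
    (P.isMeroAlong_secQuotient hσ hσ0 hτ U s hU hs hps f hσf).2.2.1⟩
  rintro h0
  exact hx (by rw [hσf x hxU, h0, cls_zero])

/-- The identity `τ = [m, σ_M m] ⊗ (τ / σ)` presents `τ` with coefficient `σ_M m`, so
`funOfSecK_smul_eq` applies. -/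
theorem pullbackAt_proj_secQuotient [FiniteDimensional ℂ EX] (hd : Module.finrank ℂ EX = d)
    {Ω : Form EM M d} {m : M}
    (hΩ : ∃ κ : FormAt EX d (P.proj m), pullbackAt P.proj m κ = Ω m) (hΩ0 : Ω m ≠ 0)
    {σ : P.Sec χ} {τ : P.SecK χ d} (hm : σ (P.proj m) ≠ 0) :
    pullbackAt (E := EM) P.proj m (P.secQuotient σ τ (P.proj m))
      = P.funOfSecK χ Ω τ m • (P.funOfSec χ σ m)⁻¹ • Ω m := by
  have h := P.tmul_secQuotient τ hm
  rw [← P.cls_funOfSec χ σ] at h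
  have h1 := P.funOfSecK_smul_eq hd hΩ hΩ0 rfl h.symm
  rw [smul_comm, h1, smul_smul, inv_mul_cancel₀ (P.funOfSec_ne_zero_iff.2 hm), one_smul]

end Residue

end EquivPrincipalBundle

theorem theorem4p1
    {EG : Type*} [NormedAddCommGroup EG] [NormedSpace ℂ EG] [FiniteDimensional ℂ EG]
    {EH : Type*} [NormedAddCommGroup EH] [NormedSpace ℂ EH] [FiniteDimensional ℂ EH]
    {EM : Type*} [NormedAddCommGroup EM] [NormedSpace ℂ EM] [FiniteDimensional ℂ EM]
    {EX : Type*} [NormedAddCommGroup EX] [NormedSpace ℂ EX] [FiniteDimensional ℂ EX]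
    {G : Type*} [Group G] [TopologicalSpace G] [ChartedSpace EG G] [LieGroup 𝓘(ℂ, EG) ω G]
    {H : Type*} [Group H] [TopologicalSpace H] [ChartedSpace EH H] [LieGroup 𝓘(ℂ, EH) ω H]
    {M : Type*} [TopologicalSpace M] [ChartedSpace EM M] [IsManifold 𝓘(ℂ, EM) ω M]
    {X : Type*} [TopologicalSpace X] [ChartedSpace EX X] [IsManifold 𝓘(ℂ, EX) ω X]
    [ConnectedSpace X]
    [MulAction G M] [MulAction H M] [MulAction G X] [SMulCommClass G H M]
    (P : EquivPrincipalBundle EG EH EM EX G H M X)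
    (d q : ℕ) (hd : Module.finrank ℂ EX = d) (hq : Module.finrank ℂ EH = q)
    (ωM : Form EM M (d + q)) (χM : H →* ℂˣ) (hCY : P.IsCYStructure ωM χM)
    (b : Fin q → TangentSpace 𝓘(ℂ, EH) (1 : H)) (hb : LinearIndependent ℂ b)
    (χ : H →* ℂˣ) (hχ : IsHolCharacter EH χ)
    (σ : P.Sec χ) (hσ : P.IsHolSec χ σ) (hσ0 : σ ≠ 0)
    (τ : P.SecK χ d) (hτ : P.IsHolSecK χ τ) :
    let Ω : Form EM M d := P.Omega ωM b
    let Ωσ : Form EM M d := P.OmegaSec χ ωM b σ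
    let σM : M → ℂ := P.funOfSec χ σ
    let τM : M → ℂ := P.funOfSecK χ Ω τ
    let τΩσ : Form EM M d := fun m => τM m • Ωσ m
    -- `σ_M` and `τ_M` are well defined holomorphic equivariant functions
    (ContMDiff 𝓘(ℂ, EM) 𝓘(ℂ, ℂ) ω σM ∧ ∀ (h : H) (m : M), σM (h • m) = χ h * σM m) ∧
    ((∀ m, P.RepresentsAt χ Ω τ m (τM m) ∧ ∀ c, P.RepresentsAt χ Ω τ m c → c = τM m) ∧
      ContMDiff 𝓘(ℂ, EM) 𝓘(ℂ, ℂ) ω τM ∧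
      ∀ (h : H) (m : M), τM (h • m) = χ h * χM h * detAd EH h * τM m) ∧
    -- `Ω_σ` is meromorphic with polar divisor `σ_M = 0`, and has no zeros off it
    (IsHolForm univ Ω ∧ (∀ m, Ω m ≠ 0) ∧ IsMeroForm univ σM Ωσ ∧ ∀ m, σM m ≠ 0 → Ωσ m ≠ 0) ∧
    -- `G`-equivariance
    (∀ g : G,
      P.IsHolSec χ (P.gammaSec χ g σ) ∧ P.IsHolSecK χ (P.gammaSecK χ g τ) ∧
      (∀ m, P.RepresentsAt χ Ω (P.gammaSecK χ g τ) m
        (P.funOfSecK χ Ω (P.gammaSecK χ g τ) m)) ∧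
      (∀ m, P.funOfSec χ (P.gammaSec χ g σ) m = σM (g⁻¹ • m)) ∧
      (∀ m, P.funOfSec χ (P.gammaSec χ g σ) m ≠ 0 →
        gammaForm g τΩσ m =
          P.funOfSecK χ Ω (P.gammaSecK χ g τ) m • P.OmegaSec χ ωM b (P.gammaSec χ g σ) m) ∧
      ((∀ m, gammaForm g ωM m = ωM m) →
        (∀ m, P.funOfSecK χ Ω (P.gammaSecK χ g τ) m = τM (g⁻¹ • m)) ∧
        ∀ m, P.funOfSec χ (P.gammaSec χ g σ) m ≠ 0 →
          gammaForm g τΩσ m = τM (g⁻¹ • m) • P.OmegaSec χ ωM b (P.gammaSec χ g σ) m)) ∧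
    -- `τ_M Ω_σ` is `H`-basic
    (∀ (x : TangentSpace 𝓘(ℂ, EH) (1 : H)) (m : M), σM m ≠ 0 →
      interiorMul (P.vecField x m) (τΩσ m) = 0) ∧
    (∀ (h : H) (m : M), σM m ≠ 0 → gammaForm h τΩσ m = τΩσ m) ∧
    -- `τ_M Ω_σ` descends to a meromorphic form on `X`
    (∃ η : Form EX X d,
      IsHolForm {x | σ x ≠ 0} η ∧
      (∀ m, σ (P.proj m) ≠ 0 → pullbackAt P.proj m (η (P.proj m)) = τΩσ m) ∧
      P.IsMeroAlong χ σ η ∧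
      (∀ x, σ x ≠ 0 → σ x ⊗ₜ[ℂ] η x = τ x) ∧
      ∀ η' : Form EX X d,
        (∀ m, σ (P.proj m) ≠ 0 → pullbackAt P.proj m (η' (P.proj m)) = τΩσ m) →
        ∀ x, σ x ≠ 0 → η' x = η x) := by
  intro Ω Ωσ σM τM τΩσ
  obtain ⟨hn, hωh, hω0, -, hωχ⟩ := hCY
  have hΩ : ∀ m, ∃ κ : FormAt EX d (P.proj m), pullbackAt P.proj m κ = Ω m :=
    fun m => P.exists_pullbackAt_proj_eq_Omega ωM hd hn hb m
  have hΩ0 : ∀ m, Ω m ≠ 0 := fun m => P.Omega_ne_zero ωM hn hb (hω0 m)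
  have hΩh : IsHolForm univ Ω := P.isHolForm_Omega ωM hωh
  have hΩH : ∀ (h : H) (m : M), ((χM h : ℂ) * detAd EH h) •
      pullbackAt (E := EM) (E' := EM) (fun m' : M => h • m') m (Ω (h • m)) = Ω m :=
    fun h m => P.smul_pullbackAt_smul_Omega ωM hq hωχ h m
  have hσMh : ContMDiff 𝓘(ℂ, EM) 𝓘(ℂ, ℂ) ω σM := P.contMDiff_funOfSec hχ hσ
  have hσMH : ∀ (h : H) (m : M), σM (h • m) = χ h * σM m := P.funOfSec_smul σ
  have hτMH : ∀ (h : H) (m : M), τM (h • m) = χ h * χM h * detAd EH h * τM m := fun h m => by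
    rw [mul_assoc (χ h : ℂ)]
    exact P.funOfSecK_smul hd hΩ hΩ0 (hΩH h m)
  have hrep : ∀ (τ' : P.SecK χ d) (m : M),
      P.RepresentsAt χ Ω τ' m (P.funOfSecK χ Ω τ' m) := fun τ' m =>
    Classical.epsilon_spec (P.exists_representsAt hd (hΩ m) (hΩ0 m))
  -- Valid also at zeros of the section: both sides contain the same inverse, which is `0` there.
  have hgamma : ∀ (g : G) (m : M), gammaForm g τΩσ m
      = P.funOfSecK χ Ω (P.gammaSecK χ g τ) m • P.OmegaSec χ ωM b (P.gammaSec χ g σ) m := by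
    intro g m
    have h1 : gammaForm g τΩσ m
        = τM (g⁻¹ • m) • (σM (g⁻¹ • m))⁻¹ • gammaForm g Ω m := rfl
    have h2 : P.OmegaSec χ ωM b (P.gammaSec χ g σ) m = (σM (g⁻¹ • m))⁻¹ • Ω m := by
      rw [EquivPrincipalBundle.OmegaSec, P.funOfSec_gammaSec]
    rw [h1, h2, smul_comm, ← P.funOfSecK_gammaSecK_smul hd hΩ hΩ0, smul_comm]
  refine ⟨⟨hσMh, hσMH⟩, ⟨fun m => ⟨hrep τ m, fun c hc =>
    P.representsAt_unique (hΩ0 m) hc (hrep τ m)⟩,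
    P.contMDiff_funOfSecK hd hΩ hΩ0 hΩh hχ hτ, hτMH⟩, ⟨hΩh, hΩ0, ⟨hσMh.contMDiffOn, ?_, ?_, Ω, hΩh,
      fun m _ hm => ?_⟩, fun m hm => smul_ne_zero (inv_ne_zero hm) (hΩ0 m)⟩,
    fun g => ⟨P.isHolSec_gammaSec hσ g, P.isHolSecK_gammaSecK hτ g, hrep _, P.funOfSec_gammaSec σ g,
      fun m _ => hgamma g m, fun hg => ?_⟩, fun x m _ => ?_, fun h m hm => ?_,
    P.secQuotient σ τ, P.isHolForm_secQuotient hσ hσ0 hτ,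
    fun m hm => P.pullbackAt_proj_secQuotient hd (hΩ m) (hΩ0 m) hm,
    P.isMeroAlong_secQuotient hσ hσ0 hτ, fun x hx => P.tmul_secQuotient τ hx,
    fun η' hη' x hx => ?_⟩
  -- Since `P.proj` is open, density on `M` reduces to the identity theorem on `X`.
  · intro m _
    refine mem_closure_iff.2 fun V hV hmV => ?_
    obtain ⟨_, ⟨m', hm', rfl⟩, hne⟩ :=
      P.exists_mem_ne_zero hσ hσ0 (P.isOpenMap_proj V hV) ⟨_, m, hmV, rfl⟩
    exact ⟨m', hm', mem_univ _, P.funOfSec_ne_zero_iff.2 hne⟩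
  · exact (hΩh.mono (subset_univ _)).smul (hσMh.contMDiffOn.inv₀ fun m hm => hm.2)
  · change σM m • (σM m)⁻¹ • Ω m = Ω m
    rw [smul_smul, mul_inv_cancel₀ hm, one_smul]
  · have hgΩ : ∀ m, gammaForm g Ω m = Ω m := fun m => by
      rw [P.gammaForm_Omega ωM g m, show gammaForm g ωM = ωM from funext hg]
    have hτg : ∀ m, P.funOfSecK χ Ω (P.gammaSecK χ g τ) m = τM (g⁻¹ • m) := fun m => by
      have h1 := P.funOfSecK_gammaSecK_smul (τ := τ) hd hΩ hΩ0 g m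
      rw [hgΩ] at h1
      exact smul_left_injective ℂ (hΩ0 m) h1
    exact ⟨hτg, fun m _ => by rw [hgamma, hτg]⟩
  · change interiorMul (P.vecField x m) (τM m • (σM m)⁻¹ • Ω m) = 0
    rw [interiorMul_smul, interiorMul_smul, P.interiorMul_vecField_Omega ωM hd hn hb, smul_zero,
      smul_zero]
  · have h1 : gammaForm h τΩσ m = τM (h⁻¹ • m) • (σM (h⁻¹ • m))⁻¹ •
      pullbackAt (E := EM) (E' := EM) (fun m' : M => h⁻¹ • m') m (Ω (h⁻¹ • m)) := rfl
    have hχ0 : (χ h⁻¹ : ℂ) ≠ 0 := Units.ne_zero _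
    change _ = τM m • (σM m)⁻¹ • Ω m
    -- Expressing `Ω m` through its pullback along `h⁻¹` supplies the factors `χM` and `detAd`
    -- gained by `τM`; the two factors `χ` cancel.
    rw [h1, hτMH, hσMH, ← hΩH h⁻¹ m, smul_smul, smul_smul, smul_smul]
    congr 1
    field_simp
  · obtain ⟨m, rfl⟩ := P.exists_proj_eq x
    refine P.pullbackAt_proj_injective m ((hη' m hx).trans ?_)
    exact (P.pullbackAt_proj_secQuotient hd (hΩ m) (hΩ0 m) hx).symm
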